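/- Let $S\subset\mathbb P^3_{\mathbb R}$ be the quadric $w^2=x^2+y^2+z^2$, with complexification $S_{\mathbb C}$, standard antiholomorphic involution $\sigma$, and real points $S(\mathbb R)=\{x^2+y^2+z^2=1\}$ in the chart $w=1$. Let $\pi:S\dashrightarrow\mathbb P^1$, $(w:x:y:z)\mapsto(w:z)$. Let $\mathrm{Bir}(S)$ be the group of birational maps of $S$ defined over $\mathbb R$ (i.e. birational maps of $S_{\mathbb C}$ commuting with $\sigma$), let $\mathrm{Aut}(S(\mathbb R))\subset\mathrm{Bir}(S)$ be the group of those $f$ such that $f$ and $f^{-1}$ are defined at every real point of $S$, let $\mathrm{Aut}(S(\mathbb R)/\pi)=\{f\in\mathrm{Aut}(S(\mathbb R)) : \pi f=\pi\}$, and let $\mathrm{Aut}^+(S(\mathbb R)/\pi)$ be the subgroup of the elements inducing orientation-preserving diffeomorphisms of the sphere $S(\mathbb R)$. Let $\psi:S_{\mathbb C}\dashrightarrow\mathbb A^2_{\mathbb C}$ be the birational map $(x,y,z)\mapsto(x-iy,z)$, and let $\mathrm{PGL}(2,\mathbb C(z))$ act on $\mathbb A^2_{\mathbb C}$ by birational maps,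 the class of $\left[\begin{smallmatrix}\alpha&\beta\\ \gamma&\delta\end{smallmatrix}\right]$ acting as $(t,z)\mapsto\left(\frac{\alpha(z)t+\beta(z)}{\gamma(z)t+\delta(z)},z\right)$. A bar denotes conjugation of the coefficients of elements of $\mathbb C(z)$. Put $h=1-z^2$, let $\tau\in\mathrm{PGL}(2,\mathbb C(z))$ be the class of $\left[\begin{smallmatrix}0&h\\1&0\end{smallmatrix}\right]$, and let $\mathscr G=\{A\in\mathrm{PGL}(2,\mathbb C(z)) : \tau A\tau=\bar A\}$. Then $f\mapsto\psi f\psi^{-1}$ defines isomorphisms of $\mathrm{Aut}(S(\mathbb R)/\pi)$ and of $\mathrm{Aut}^+(S(\mathbb R)/\pi)$ onto subgroups $\mathscr H$ and $\mathscr H_0$ of $\mathrm{PGL}(2,\mathbb C(z))$, both contained in $\mathscr G$. The element $\tau$ has order $2$, and $\mathscr H=\mathscr H_0\rtimes\langle\tau\rangle$ as an internal semidirect product: $\mathscr H_0$ is normal in $\mathscr H$, $\mathscr H_0\cap\langle\tau\rangle=1$, and $\mathscr H_0$ and $\langle\tau\rangle$ generate $\mathscr H$. Moreover, $\mathscr H_0$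 is the set of classes of the matrices $$\begin{bmatrix}a&bh\\ \bar b&\bar a\end{bmatrix},\qquad a,b\in\mathbb C[z],$$ such that the determinant $a\bar a-b\bar b\,h\in\mathbb R[z]$ is positive at every point of $\mathbb R$. -/

import Mathlib

open scoped MatrixGroups

noncomputable section

namespace SphereBir

/-! ## The complexified sphere, its function field and its real structure -/

/-- The equation `x² + y² + z² - 1` of the sphere in the chart `w = 1`; the variables
`X 0, X 1, X 2` are `x, y, z`. -/
def sphereEq : MvPolynomial (Fin 3) ℂ :=
  MvPolynomial.X 0 ^ 2 + MvPolynomial.X 1 ^ 2 + MvPolynomial.X 2 ^ 2 - 1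

/-- The linear change of coordinates `(x, y, z) ↦ (x - i y, x + i y, z)`. -/
def isotropicCoords : MvPolynomial (Fin 3) ℂ ≃ₐ[ℂ] MvPolynomial (Fin 3) ℂ :=
  AlgEquiv.ofAlgHom
    (MvPolynomial.aeval ![MvPolynomial.X 0 - MvPolynomial.C Complex.I * MvPolynomial.X 1,
      MvPolynomial.X 0 + MvPolynomial.C Complex.I * MvPolynomial.X 1, MvPolynomial.X 2])
    (MvPolynomial.aeval ![MvPolynomial.C (1 / 2) * (MvPolynomial.X 0 + MvPolynomial.X 1),
      MvPolynomial.C (Complex.I / 2) * (MvPolynomial.X 0 - MvPolynomial.X 1),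
      MvPolynomial.X 2])
    (by
      have h2 : (MvPolynomial.C (1 / 2 : ℂ) : MvPolynomial (Fin 3) ℂ) * 2 = 1 := by
        rw [show (2 : MvPolynomial (Fin 3) ℂ) = MvPolynomial.C 2 from (map_ofNat _ 2).symm,
          ← map_mul]
        norm_num
      have hI : (MvPolynomial.C (Complex.I / 2) : MvPolynomial (Fin 3) ℂ) * MvPolynomial.C Complex.I
          = - MvPolynomial.C (1 / 2 : ℂ) := by
        rw [← map_mul, ← map_neg]
        congr 1
        linear_combination (1 / 2 : ℂ) * Complex.I_mul_I
      ext1 i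
      fin_cases i
      · simp only [AlgHom.comp_apply, MvPolynomial.aeval_X, AlgHom.id_apply, map_mul, map_add,
          MvPolynomial.algHom_C, MvPolynomial.algebraMap_eq, Fin.zero_eta, Matrix.cons_val]
        linear_combination MvPolynomial.X 0 * h2
      · simp only [AlgHom.comp_apply, MvPolynomial.aeval_X, AlgHom.id_apply, map_mul, map_sub,
          MvPolynomial.algHom_C, MvPolynomial.algebraMap_eq, Fin.mk_one, Matrix.cons_val]
        linear_combination MvPolynomial.X 1 * h2 - 2 * MvPolynomial.X 1 * hI
      · simp)
    (by
      have h2 : (MvPolynomial.C (1 / 2 : ℂ) : MvPolynomial (Fin 3) ℂ) * 2 = 1 := by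
        rw [show (2 : MvPolynomial (Fin 3) ℂ) = MvPolynomial.C 2 from (map_ofNat _ 2).symm,
          ← map_mul]
        norm_num
      have hI : (MvPolynomial.C Complex.I : MvPolynomial (Fin 3) ℂ) * MvPolynomial.C (Complex.I / 2)
          = - MvPolynomial.C (1 / 2 : ℂ) := by
        rw [← map_mul, ← map_neg]
        congr 1
        linear_combination (1 / 2 : ℂ) * Complex.I_mul_I
      ext1 i
      fin_cases i
      · simp only [AlgHom.comp_apply, MvPolynomial.aeval_X, AlgHom.id_apply, map_mul, map_sub,
          MvPolynomial.algHom_C, MvPolynomial.algebraMap_eq, Fin.zero_eta, Matrix.cons_val]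
        linear_combination MvPolynomial.X 0 * h2 -
          (MvPolynomial.X 0 - MvPolynomial.X 1) * hI
      · simp only [AlgHom.comp_apply, MvPolynomial.aeval_X, AlgHom.id_apply, map_mul, map_add,
          MvPolynomial.algHom_C, MvPolynomial.algebraMap_eq, Fin.mk_one, Matrix.cons_val]
        linear_combination MvPolynomial.X 1 * h2 +
          (MvPolynomial.X 0 - MvPolynomial.X 1) * hI
      · simp)

theorem irreducible_sphereEq : Irreducible sphereEq := by
  have hX : ¬ (MvPolynomial.X 0 : MvPolynomial (Fin 3) ℂ) ∣ MvPolynomial.X 2 ^ 2 - 1 := by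
    rintro ⟨q, hq⟩
    have := congrArg (MvPolynomial.eval (fun _ => (0 : ℂ))) hq
    simp at this
  have h1 : Irreducible (MvPolynomial.X 0 * MvPolynomial.X 1 + (MvPolynomial.X 2 ^ 2 - 1) :
      MvPolynomial (Fin 3) ℂ) := by
    refine MvPolynomial.irreducible_mul_X_add _ _ 1 (MvPolynomial.X_ne_zero 0) ?_ ?_ ?_
    · simp [MvPolynomial.vars_X]
    · intro h
      have h' := MvPolynomial.vars_sub_subset _ h
      rw [Finset.mem_union] at h'
      rcases h' with h' | h'
      · have := MvPolynomial.vars_pow _ _ h'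
        simp [MvPolynomial.vars_X] at this
      · simp at h'
    · exact ((MvPolynomial.X_prime (i := (0 : Fin 3)) (R := ℂ)).irreducible.isRelPrime_iff_not_dvd).2 hX
  have h2 : isotropicCoords (MvPolynomial.X 0 * MvPolynomial.X 1 + (MvPolynomial.X 2 ^ 2 - 1)) =
      sphereEq := by
    have hI : (MvPolynomial.C Complex.I : MvPolynomial (Fin 3) ℂ) * MvPolynomial.C Complex.I
          = - 1 := by
        rw [← map_mul, Complex.I_mul_I]
        simp
    simp only [isotropicCoords, AlgEquiv.ofAlgHom_apply, map_add, map_mul, map_sub, map_pow,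
      MvPolynomial.aeval_X, map_one, Matrix.cons_val, sphereEq]
    linear_combination (- MvPolynomial.X 1 ^ 2) * hI
  rw [← h2]
  exact (MulEquiv.irreducible_iff isotropicCoords).2 h1

/-- The coordinate ring `ℂ[x, y, z] / (x² + y² + z² - 1)` of the chart `w = 1` of `S_ℂ`. -/
abbrev CoordRing : Type := MvPolynomial (Fin 3) ℂ ⧸ Ideal.span {sphereEq}

instance : IsDomain CoordRing :=
  have : (Ideal.span {sphereEq}).IsPrime :=
    (Ideal.span_singleton_prime irreducible_sphereEq.ne_zero).2 irreducible_sphereEq.prime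
  Ideal.Quotient.isDomain _

/-- The function field `ℂ(S)` of the surface `S_ℂ`. -/
abbrev FunField : Type := FractionRing CoordRing

/-- The rational function on `S_ℂ` given by a polynomial in `x, y, z`. -/
def ofPoly : MvPolynomial (Fin 3) ℂ →ₐ[ℂ] FunField :=
  (IsScalarTower.toAlgHom ℂ CoordRing FunField).comp (Ideal.Quotient.mkₐ ℂ _)

/-- Conjugation of the coefficients of polynomials in `x, y, z`. -/
def conjPoly : MvPolynomial (Fin 3) ℂ ≃+* MvPolynomial (Fin 3) ℂ :=
  MvPolynomial.mapEquiv (Fin 3) (starRingAut (R := ℂ))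

theorem conjPoly_sphereEq : conjPoly sphereEq = sphereEq := by
  simp [conjPoly, sphereEq]

/-- Conjugation of the coefficients on the coordinate ring. -/
def conjCoord : CoordRing ≃+* CoordRing :=
  Ideal.quotientEquiv _ _ conjPoly (by
    rw [Ideal.map_span, Set.image_singleton]
    exact congrArg (fun q => Ideal.span {q}) conjPoly_sphereEq.symm)

/-- The action `g ↦ conj ∘ g ∘ σ` of the antiholomorphic involution `σ` of `S_ℂ` on the function
field: it fixes `x, y, z` and conjugates the coefficients. -/
def sigma : FunField ≃+* FunField :=
  IsFractionRing.ringEquivOfRingEquiv conjCoord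

/-! ## Birational maps -/

/-- The group of birational transformations of `S_ℂ`. A birational map `f` is given by its
comorphism `f^* = f.unop : ℂ(S) → ℂ(S)`, `g ↦ g ∘ f`; since `(f ∘ g)^* = g^* ∘ f^*`, the product in
the opposite group is the composition of maps. -/
abbrev BirC : Type := (FunField ≃ₐ[ℂ] FunField)ᵐᵒᵖ

/-- `Bir(S)`: the birational maps of `S_ℂ` that commute with `σ`, i.e. those defined over `ℝ`. -/
def birS : Subgroup BirC where
  carrier := {f | ∀ g, f.unop (sigma g) = sigma (f.unop g)}
  one_mem' := fun _ => rfl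
  mul_mem' := by
    intro f g hf hg k
    simp only [Set.mem_ofPred_eq] at hf hg
    simp [hf, hg]
  inv_mem' := by
    intro f hf k
    simp only [Set.mem_ofPred_eq] at hf
    apply f.unop.injective
    rw [hf]
    simp

/-- `Bir(S/π)`: the elements `f` of `Bir(S)` with `π ∘ f = π`, where `π(w:x:y:z) = (w:z)`. -/
def birOver : Subgroup BirC where
  carrier := {f | f ∈ birS ∧ f.unop (ofPoly (MvPolynomial.X 2)) = ofPoly (MvPolynomial.X 2)}
  one_mem' := ⟨birS.one_mem, rfl⟩
  mul_mem' := by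
    rintro f g ⟨hf, hf'⟩ ⟨hg, hg'⟩
    exact ⟨birS.mul_mem hf hg, by simp [hf', hg']⟩
  inv_mem' := by
    rintro f ⟨hf, hf'⟩
    refine ⟨birS.inv_mem hf, ?_⟩
    apply f.unop.injective
    rw [hf']
    simp

/-! ## Birational diffeomorphisms -/

/-- The real affine space containing the sphere `S(ℝ)`. -/
abbrev E3 : Type := EuclideanSpace ℝ (Fin 3)

/-- The set `S(ℝ)` of real points of `S`; they all lie in the chart `w = 1`. -/
abbrev realSphere : Set E3 := Metric.sphere 0 1

/-- The rational function `g` is regular at the point `p` of `S(ℝ)`, with value `c ∈ ℂ`. -/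
def HasValueAt (g : FunField) (p : E3) (c : ℂ) : Prop :=
  ∃ u v : MvPolynomial (Fin 3) ℂ,
    MvPolynomial.eval (fun i => (p i : ℂ)) v ≠ 0 ∧ g * ofPoly v = ofPoly u ∧
      c * MvPolynomial.eval (fun i => (p i : ℂ)) v = MvPolynomial.eval (fun i => (p i : ℂ)) u

/-- The homogeneous coordinates `(w : x : y : z) = (1 : x : y : z)` as functions on `S_ℂ`. -/
def homCoord : Fin 4 → FunField :=
  ![1, ofPoly (MvPolynomial.X 0), ofPoly (MvPolynomial.X 1), ofPoly (MvPolynomial.X 2)]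

/-- The rational map `f : S ⇢ S ⊂ ℙ³` is defined at the real point `p`, with image the point
`(v 0 : v 1 : v 2 : v 3)` of `ℙ³(ℂ)`: after multiplication by a common rational function, the
homogeneous coordinates of `f` are regular at `p` and take there the values `v i`, not all zero. -/
def HasImageAt (f : BirC) (p : E3) (v : Fin 4 → ℂ) : Prop :=
  v ≠ 0 ∧ ∃ l : FunField, ∀ i, HasValueAt (l * f.unop (homCoord i)) p (v i)

/-- `f` is defined at every real point of `S`. -/
def DefinedOnReal (f : BirC) : Prop :=
  ∀ p ∈ realSphere, ∃ v, HasImageAt f p v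

/-- `Aut(S(ℝ))`: the birational maps `f` of `S` such that `f` and `f⁻¹` are defined at every
real point. -/
def autReal : Set BirC := {f | f ∈ birS ∧ DefinedOnReal f ∧ DefinedOnReal f⁻¹}

/-- `Aut(S(ℝ)/π)`: the elements `f` of `Aut(S(ℝ))` with `π ∘ f = π`. -/
def autRealOver : Set BirC := autReal ∩ {f | f ∈ birOver}

/-- The signed volume of the parallelepiped spanned by three vectors of `ℝ³`. -/
def vol (p u v : E3) : ℝ := (EuclideanSpace.basisFun (Fin 3) ℝ).toBasis.det ![p, u, v]

/-- A map `F` of the sphere `S(ℝ)` is differentiable and preserves the orientation: its differential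
at each `p` maps the bases `(u, v)` of the tangent plane `p^⊥` that are positively oriented with
respect to the outer normal `p` to positively oriented bases of the tangent plane at `F p`. -/
def PreservesOrientation (F : E3 → E3) : Prop :=
  ∀ p ∈ realSphere, ∃ L : E3 →L[ℝ] E3, HasFDerivWithinAt F L realSphere p ∧
    ∀ u v : E3, inner ℝ p u = 0 → inner ℝ p v = 0 → 0 < vol p u v → 0 < vol (F p) (L u) (L v)

/-- `F` restricts to the map `S(ℝ) → S(ℝ)` induced by the birational map `f`. -/
def Induces (f : BirC) (F : E3 → E3) : Prop :=
  ∀ p ∈ realSphere, F p ∈ realSphere ∧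
    HasImageAt f p ![1, (F p 0 : ℂ), (F p 1 : ℂ), (F p 2 : ℂ)]

/-- `Aut⁺(S(ℝ)/π)`: the orientation-preserving elements of `Aut(S(ℝ)/π)`. -/
def autRealOverPlus : Set BirC :=
  {f | f ∈ autRealOver ∧ ∃ F : E3 → E3, Induces f F ∧ PreservesOrientation F}

/-! ## The group `PGL(2, ℂ(z))` and the map `ψ` -/

/-- The polynomials in `z` inject into `ℂ(S)`. -/
theorem ofPoly_z_injective :
    Function.Injective (Polynomial.aeval (R := ℂ) (ofPoly (MvPolynomial.X 2))) := by
  rw [injective_iff_map_eq_zero]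
  intro q hq
  have h1 : Polynomial.aeval (ofPoly (MvPolynomial.X 2)) q =
      ofPoly (Polynomial.aeval (MvPolynomial.X 2) q) := by
    rw [Polynomial.aeval_algHom_apply]
  rw [h1] at hq
  have h2 : Polynomial.aeval (MvPolynomial.X 2 : MvPolynomial (Fin 3) ℂ) q ∈
      Ideal.span {sphereEq} := by
    have h3 : algebraMap CoordRing FunField (Ideal.Quotient.mk _
      (Polynomial.aeval (MvPolynomial.X 2 : MvPolynomial (Fin 3) ℂ) q)) = 0 := hq
    rw [map_eq_zero_iff _ (IsFractionRing.injective CoordRing FunField)] at h3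
    exact Ideal.Quotient.eq_zero_iff_mem.1 h3
  rw [Ideal.mem_span_singleton] at h2
  obtain ⟨r, hr⟩ := h2
  apply Polynomial.funext
  intro c
  obtain ⟨s, hs⟩ := IsAlgClosed.exists_pow_nat_eq (1 - c ^ 2) (n := 2) two_pos
  have h4 := congrArg (MvPolynomial.aeval (R := ℂ) ![s, 0, c]) hr
  rw [map_mul, ← Polynomial.aeval_algHom_apply] at h4
  simpa [sphereEq, hs, Polynomial.aeval_def, Polynomial.eval₂_eq_eval_map] using h4

/-- The inclusion `ℂ(z) → ℂ(S)`, i.e. the comorphism of the projection `(x, y, z) ↦ z`. -/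
def zEmb : RatFunc ℂ →ₐ[ℂ] FunField :=
  RatFunc.liftAlgHom (Polynomial.aeval (ofPoly (MvPolynomial.X 2)))
    (nonZeroDivisors_le_comap_nonZeroDivisors_of_injective _ ofPoly_z_injective)

/-- The rational function `t = x - i y` on `S_ℂ`; the birational map `ψ : S_ℂ ⇢ 𝔸²` is
`ψ = (x - i y, z)`. -/
def tFun : FunField :=
  ofPoly (MvPolynomial.X 0 - MvPolynomial.C Complex.I * MvPolynomial.X 1)

/-- The identity `ψ ∘ f = A ∘ ψ` of rational maps `S_ℂ ⇢ 𝔸²`, that is, `A = ψ f ψ⁻¹`, where the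
class `A` of the matrix `M = [[α, β], [γ, δ]]` acts on `𝔸²` by
`(t, z) ↦ ((α(z) t + β(z)) / (γ(z) t + δ(z)), z)`. -/
def PsiConj (f : BirC) (A : PGL(2, RatFunc ℂ)) : Prop :=
  ∃ M : GL (Fin 2) (RatFunc ℂ), Matrix.ProjGenLinGroup.mk M = A ∧
    f.unop tFun = (zEmb (M 0 0) * tFun + zEmb (M 0 1)) / (zEmb (M 1 0) * tFun + zEmb (M 1 1)) ∧
    f.unop (ofPoly (MvPolynomial.X 2)) = ofPoly (MvPolynomial.X 2)

/-- `ψ G ψ⁻¹` as a subset of `PGL(2, ℂ(z))`, for a set `G` of birational maps. -/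
def psiImage (G : Set BirC) : Set (PGL(2, RatFunc ℂ)) := {A | ∃ f ∈ G, PsiConj f A}

/-- Conjugation of the coefficients of polynomials in `z`. -/
def conjZ : Polynomial ℂ →+* Polynomial ℂ := Polynomial.mapRingHom (starRingEnd ℂ)

theorem conjZ_injective : Function.Injective conjZ :=
  Polynomial.map_injective _ (starRingEnd ℂ).injective

/-- Conjugation of the coefficients of rational functions in `z`. -/
def conjRat : RatFunc ℂ →+* RatFunc ℂ :=
  RatFunc.mapRingHom conjZ
    (nonZeroDivisors_le_comap_nonZeroDivisors_of_injective _ conjZ_injective)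

/-- The polynomial `h = 1 - z²`. -/
def hPoly : Polynomial ℂ := 1 - Polynomial.X ^ 2

theorem hPoly_ne_zero : hPoly ≠ 0 := by
  intro h
  have := congrArg (Polynomial.eval 0) h
  simp [hPoly] at this

/-- The matrix `[[0, h], [1, 0]]`. -/
def tauGL : GL (Fin 2) (RatFunc ℂ) :=
  Matrix.GeneralLinearGroup.mkOfDetNeZero
    !![0, algebraMap (Polynomial ℂ) (RatFunc ℂ) hPoly; 1, 0]
    (by simp [Matrix.det_fin_two, hPoly_ne_zero])

/-- The class `τ` of `[[0, h], [1, 0]]` in `PGL(2, ℂ(z))`. -/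
def tau : PGL(2, RatFunc ℂ) := Matrix.ProjGenLinGroup.mk tauGL

/-- The set `𝒢 = {A ∈ PGL(2, ℂ(z)) | τ A τ = Ā}`. -/
def scriptG : Set (PGL(2, RatFunc ℂ)) :=
  {A | tau * A * tau = Matrix.ProjGenLinGroup.map conjRat A}

/-- The monoid `ℝ[z]₊` of real polynomials that are positive at every real point. -/
def posPoly : Set (Polynomial ℝ) := {q | ∀ r : ℝ, 0 < q.eval r}

/-- The classes of the matrices `[[a, b h], [b̄, ā]]` with `a, b ∈ ℂ[z]` and
`a ā - b b̄ h ∈ ℝ[z]₊`. -/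
def explicitH0 : Set (PGL(2, RatFunc ℂ)) :=
  {A | ∃ a b : Polynomial ℂ,
    (∃ D ∈ posPoly, D.map (algebraMap ℝ ℂ) = a * conjZ a - b * conjZ b * hPoly) ∧
    ∃ M : GL (Fin 2) (RatFunc ℂ), Matrix.ProjGenLinGroup.mk M = A ∧
      (M : Matrix (Fin 2) (Fin 2) (RatFunc ℂ)) =
        !![algebraMap (Polynomial ℂ) (RatFunc ℂ) a, algebraMap (Polynomial ℂ) (RatFunc ℂ) (b * hPoly);
          algebraMap (Polynomial ℂ) (RatFunc ℂ) (conjZ b),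
          algebraMap (Polynomial ℂ) (RatFunc ℂ) (conjZ a)]}

end SphereBir

end

noncomputable section

namespace SphereBir

section

open MvPolynomial (eval)

/-! ## The function field as a field of rational functions in `t` over `ℂ(z)` -/

/-! Put `u = x + iy`. The equation of the sphere reads `tu = h`, so the function field of `S_ℂ` is
purely transcendental over `K = ℂ(z)`, generated by `t` (`ratEquiv`). Birational maps of `S_ℂ` over
the `z`-line are therefore the automorphisms of `K(t)` over `K`, that is, elements of `PGL(2, K)`.
Since `σ` conjugates coefficients and sends `t` to `u = h/t`, which is `τ` applied to `t`, commuting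
with `σ` is exactly the condition defining `𝒢` (`PsiConj.mem_birS_iff`).

Hilbert 90 for complex conjugation on `K` brings every element of `𝒢` to the form `[[a, bh], [b̄,
ā]]`, with `a, b` polynomials without common real root (`exists_isStd_of_mem_scriptG`). At real
points of the sphere `u = t̄` and `h = t t̄`, so such a class acts on the circle at height `z` by `t
↦ t m / m̄` with `m = a + b t̄`. A zero of `m` forces the determinant `a ā - b b̄ h` to vanish at
that height. Hence a determinant without real zeros gives a map defined at all real points, and
likewise for the inverse, which has the same determinant. Conversely, a zero of the determinant in
`(-1, 1)` contracts a circle minus one point to a point, so the inverse cannot be defined there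
(`IsStd.detFun_ne_zero`).

For an element of `Aut(S(ℝ)/π)` the determinant thus has constant sign on `(-1, 1)`. Outside `[-1,
1]` it is automatically positive, and at `±1` it equals `|a|²`. If the inner sign is positive,
comparing orders of vanishing at `±1` gives positivity everywhere. If it is negative, then `a`
vanishes at `±1`, so `h` divides `a`, and multiplying by `τ` and dividing by `h` gives a matrix with
positive determinant (`detFun_sign_cases`). This yields `ℋ = ℋ₀ ∪ τℋ₀`. The Jacobian on the sphere
is the determinant divided by `|m|²` (`exists_fderiv_realMap`), so its sign decides the orientation
and `ℋ₀` is the orientation-preserving part. -/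

theorem ofPoly_eq_zero_iff (p : MvPolynomial (Fin 3) ℂ) : ofPoly p = 0 ↔ sphereEq ∣ p := by
  have h : ofPoly p = algebraMap CoordRing FunField (Ideal.Quotient.mk _ p) := rfl
  rw [h, map_eq_zero_iff _ (IsFractionRing.injective CoordRing FunField),
    Ideal.Quotient.eq_zero_iff_mem, Ideal.mem_span_singleton]

theorem eval_eq_of_ofPoly_eq {p q : MvPolynomial (Fin 3) ℂ} (h : ofPoly p = ofPoly q)
    {s : Fin 3 → ℂ} (hs : eval s sphereEq = 0) : eval s p = eval s q := by
  rw [← sub_eq_zero, ← map_sub, ofPoly_eq_zero_iff] at h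
  obtain ⟨r, hr⟩ := h
  have := congrArg (eval s) hr
  rw [map_mul, hs, zero_mul, map_sub] at this
  exact sub_eq_zero.1 this

theorem exists_ofPoly_div (g : FunField) :
    ∃ u v : MvPolynomial (Fin 3) ℂ, ofPoly v ≠ 0 ∧ g = ofPoly u / ofPoly v := by
  obtain ⟨x, y, hy, rfl⟩ := IsFractionRing.div_surjective CoordRing g
  obtain ⟨u, rfl⟩ := Ideal.Quotient.mk_surjective x
  obtain ⟨v, rfl⟩ := Ideal.Quotient.mk_surjective y
  refine ⟨u, v, ?_, rfl⟩
  change algebraMap CoordRing FunField _ ≠ 0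
  rw [Ne, map_eq_zero_iff _ (IsFractionRing.injective CoordRing FunField)]
  exact nonZeroDivisors.ne_zero hy

/-- The rational function `x + i y`. -/
def uFun : FunField :=
  ofPoly (MvPolynomial.X 0 + MvPolynomial.C Complex.I * MvPolynomial.X 1)

theorem zEmb_algebraMap (q : Polynomial ℂ) :
    zEmb (algebraMap _ _ q) = ofPoly (Polynomial.aeval (MvPolynomial.X 2) q) := by
  rw [← Polynomial.aeval_algHom_apply]
  have := RatFunc.liftAlgHom_apply_div (L := FunField) (S := ℂ)
    (Polynomial.aeval (ofPoly (MvPolynomial.X 2)))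
    (nonZeroDivisors_le_comap_nonZeroDivisors_of_injective _ ofPoly_z_injective) q 1
  simpa using! this

theorem eval_aeval_X_two (s : Fin 3 → ℂ) (q : Polynomial ℂ) :
    eval s (Polynomial.aeval (MvPolynomial.X 2) q) = q.eval (s 2) := by
  have := Polynomial.aeval_algHom_apply (MvPolynomial.aeval (R := ℂ) s) (MvPolynomial.X 2) q
  simp only [MvPolynomial.aeval_X] at this
  rw [Polynomial.coe_aeval_eq_eval] at this
  rw [this]
  rfl

theorem tFun_mul_uFun : tFun * uFun = zEmb (algebraMap _ _ hPoly) := by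
  rw [zEmb_algebraMap, tFun, uFun, ← map_mul, ← sub_eq_zero, ← map_sub, ofPoly_eq_zero_iff]
  refine ⟨1, ?_⟩
  have hI : (MvPolynomial.C Complex.I : MvPolynomial (Fin 3) ℂ) * MvPolynomial.C Complex.I
      = - 1 := by
    rw [← map_mul, Complex.I_mul_I]
    simp
  simp only [hPoly, map_sub, map_one, map_pow, Polynomial.aeval_X, sphereEq]
  linear_combination (- MvPolynomial.X 1 ^ 2) * hI

theorem zEmb_h_ne_zero : zEmb (algebraMap _ _ hPoly) ≠ 0 := by
  rw [Ne, map_eq_zero, map_eq_zero_iff _ (RatFunc.algebraMap_injective ℂ)]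
  exact hPoly_ne_zero

theorem tFun_ne_zero : tFun ≠ 0 := fun h => zEmb_h_ne_zero (by rw [← tFun_mul_uFun, h, zero_mul])

theorem uFun_eq : uFun = zEmb (algebraMap _ _ hPoly) / tFun := by
  rw [eq_div_iff tFun_ne_zero, mul_comm, tFun_mul_uFun]

theorem ofPoly_X_zero : ofPoly (MvPolynomial.X 0) =
    ofPoly (MvPolynomial.C (1 / 2)) * (tFun + uFun) := by
  have h2 : (MvPolynomial.C (1 / 2 : ℂ) : MvPolynomial (Fin 3) ℂ) * 2 = 1 := by
    rw [show (2 : MvPolynomial (Fin 3) ℂ) = MvPolynomial.C 2 from (map_ofNat _ 2).symm, ← map_mul]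
    norm_num
  rw [tFun, uFun, ← map_add, ← map_mul]
  congr 1
  linear_combination (- MvPolynomial.X 0) * h2

theorem ofPoly_X_one : ofPoly (MvPolynomial.X 1) =
    ofPoly (MvPolynomial.C (Complex.I / 2)) * (tFun - uFun) := by
  have hI : (MvPolynomial.C (Complex.I / 2) : MvPolynomial (Fin 3) ℂ) * MvPolynomial.C Complex.I
      = - MvPolynomial.C (1 / 2 : ℂ) := by
    rw [← map_mul, ← map_neg]
    congr 1
    linear_combination (1 / 2 : ℂ) * Complex.I_mul_I
  have h2 : (MvPolynomial.C (1 / 2 : ℂ) : MvPolynomial (Fin 3) ℂ) * 2 = 1 := by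
    rw [show (2 : MvPolynomial (Fin 3) ℂ) = MvPolynomial.C 2 from (map_ofNat _ 2).symm, ← map_mul]
    norm_num
  rw [tFun, uFun, ← map_sub, ← map_mul]
  congr 1
  linear_combination (- MvPolynomial.X 1) * h2 + 2 * MvPolynomial.X 1 * hI

theorem exists_sphere_point (t z : ℂ) (ht : t ≠ 0) :
    ∃ s : Fin 3 → ℂ, eval s sphereEq = 0 ∧ s 0 - Complex.I * s 1 = t ∧ s 2 = z := by
  -- The point is determined by `x - iy = t` and `x + iy = (1 - z²)/t`.
  refine ⟨![(t + (1 - z ^ 2) / t) / 2, Complex.I * (t - (1 - z ^ 2) / t) / 2, z], ?_, ?_, rfl⟩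
  · simp only [sphereEq, map_sub, map_add, map_pow, MvPolynomial.eval_X, map_one,
      Matrix.cons_val]
    field_simp
    linear_combination (t ^ 2 - (1 - z ^ 2)) ^ 2 * Complex.I_sq
  · simp only [Matrix.cons_val]
    linear_combination (-(t - (1 - z ^ 2) / t) / 2) * Complex.I_sq

/-- A relation in the function field holds at every point of the surface. Since `(t, z)` takes every
value with `t ≠ 0` there, the polynomial vanishes at infinitely many `t` for each `z`. -/
theorem evalEval_eq_zero_of_eval₂_eq_zero {P : Polynomial (Polynomial ℂ)}
    (hP : P.eval₂ ((zEmb : RatFunc ℂ →+* FunField).comp (algebraMap _ _)) tFun = 0) : P = 0 := by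
  have key : ∀ t z : ℂ, t ≠ 0 → (P.map (Polynomial.evalRingHom z)).eval t = 0 := by
    intro t z ht
    obtain ⟨s, hs, rfl, rfl⟩ := exists_sphere_point t z ht
    set φ : Polynomial ℂ →+* MvPolynomial (Fin 3) ℂ :=
      (Polynomial.aeval (R := ℂ) (MvPolynomial.X 2)).toRingHom with hφ
    have hf : (zEmb : RatFunc ℂ →+* FunField).comp (algebraMap _ _) = ofPoly.toRingHom.comp φ :=
      RingHom.ext fun q => zEmb_algebraMap q
    have hg : (eval s).comp φ = Polynomial.evalRingHom (s 2) :=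
      RingHom.ext fun q => eval_aeval_X_two s q
    have h1 := Polynomial.hom_eval₂ P φ ofPoly.toRingHom
      (MvPolynomial.X 0 - MvPolynomial.C Complex.I * MvPolynomial.X 1)
    rw [← hf] at h1
    have h2 := eval_eq_of_ofPoly_eq ((h1.trans hP).trans (map_zero ofPoly).symm) hs
    rw [Polynomial.hom_eval₂, hg] at h2
    rw [Polynomial.eval_map]
    simpa using h2
  have key2 : ∀ z : ℂ, P.map (Polynomial.evalRingHom z) = 0 := by
    intro z
    refine Polynomial.eq_zero_of_infinite_isRoot _ (Set.Infinite.mono (s := {0}ᶜ) ?_ ?_)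
    · intro t ht
      exact key t z ht
    · exact (Set.finite_singleton (0 : ℂ)).infinite_compl
  ext1 n
  apply Polynomial.funext
  intro z
  simpa using congrArg (fun Q => Q.coeff n) (key2 z)

theorem tFun_transcendental :
    Function.Injective (Polynomial.eval₂RingHom (zEmb : RatFunc ℂ →+* FunField) tFun) := by
  rw [injective_iff_map_eq_zero]
  intro q hq
  obtain ⟨b, hb, h⟩ := IsLocalization.integerNormalization_spec
    (nonZeroDivisors (Polynomial ℂ)) q
  have h2 := evalEval_eq_zero_of_eval₂_eq_zero
    (P := IsLocalization.integerNormalization (nonZeroDivisors (Polynomial ℂ)) q) (by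
      rw [← Polynomial.eval₂_map, h, Algebra.smul_def, Polynomial.eval₂_mul]
      rw [Polynomial.coe_eval₂RingHom] at hq
      rw [hq, mul_zero])
  exact (IsLocalization.integerNormalization_eq_zero_iff le_rfl q).1 h2

/-- The homomorphism from `ℂ(z)(T)` to the function field sending `T` to `t`. -/
def ratHom : RatFunc (RatFunc ℂ) →+* FunField :=
  RatFunc.liftRingHom (Polynomial.eval₂RingHom (zEmb : RatFunc ℂ →+* FunField) tFun)
    (nonZeroDivisors_le_comap_nonZeroDivisors_of_injective _ tFun_transcendental)

@[simp]
theorem ratHom_algebraMap (q : Polynomial (RatFunc ℂ)) :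
    ratHom (algebraMap _ _ q) = q.eval₂ (zEmb : RatFunc ℂ →+* FunField) tFun :=
  RatFunc.liftRingHom_algebraMap _ _ _

@[simp]
theorem ratHom_C (k : RatFunc ℂ) : ratHom (RatFunc.C k) = zEmb k := by
  rw [← RatFunc.algebraMap_C, ratHom_algebraMap]
  simp

@[simp]
theorem ratHom_X : ratHom RatFunc.X = tFun := by
  rw [← RatFunc.algebraMap_X, ratHom_algebraMap]
  simp

/-- The coordinates `x` and `y` are linear combinations of `t` and `u = h/t`. -/
theorem ratHom_surjective : Function.Surjective ratHom := by
  have hdiv : ∀ x y, x ∈ ratHom.range → y ∈ ratHom.range → x / y ∈ ratHom.range := by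
    rintro _ _ ⟨x, rfl⟩ ⟨y, rfl⟩
    exact ⟨x / y, map_div₀ ratHom x y⟩
  have hz : ∀ k, zEmb k ∈ ratHom.range := fun k => ⟨RatFunc.C k, ratHom_C k⟩
  have hc : ∀ c : ℂ, ofPoly (MvPolynomial.C c) ∈ ratHom.range := by
    intro c
    have := hz (algebraMap _ _ (Polynomial.C c : Polynomial ℂ))
    rw [zEmb_algebraMap] at this
    simpa using this
  have ht : tFun ∈ ratHom.range := ⟨RatFunc.X, ratHom_X⟩
  have hu : uFun ∈ ratHom.range := by
    rw [uFun_eq]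
    exact hdiv _ _ (hz _) ht
  have hX : ∀ i, ofPoly (MvPolynomial.X i) ∈ ratHom.range := by
    intro i
    fin_cases i
    · exact ofPoly_X_zero ▸ mul_mem (hc (1 / 2)) (add_mem ht hu)
    · exact ofPoly_X_one ▸ mul_mem (hc (Complex.I / 2)) (sub_mem ht hu)
    · have := hz (algebraMap _ _ (Polynomial.X : Polynomial ℂ))
      rw [zEmb_algebraMap] at this
      simpa using this
  have hp : ∀ p, ofPoly p ∈ ratHom.range := by
    intro p
    induction p using MvPolynomial.induction_on with
    | C a => exact hc a
    | add p q hp hq => rw [map_add]; exact add_mem hp hq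
    | mul_X p i hp => rw [map_mul]; exact mul_mem hp (hX i)
  intro g
  obtain ⟨u, v, -, rfl⟩ := exists_ofPoly_div g
  exact hdiv _ _ (hp u) (hp v)

/-- The isomorphism `ℂ(z)(T) ≃ ℂ(S)` sending `T` to `t`. -/
def ratEquiv : RatFunc (RatFunc ℂ) ≃+* FunField :=
  RingEquiv.ofBijective ratHom ⟨RatFunc.liftRingHom_injective _ tFun_transcendental, ratHom_surjective⟩

@[simp]
theorem ratEquiv_C (k : RatFunc ℂ) : ratEquiv (RatFunc.C k) = zEmb k := ratHom_C k

@[simp]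
theorem ratEquiv_X : ratEquiv RatFunc.X = tFun := ratHom_X

theorem ratFunc_ringHom_ext {F L : Type*} [Field F] [Field L] {f g : RatFunc F →+* L}
    (hC : ∀ k, f (RatFunc.C k) = g (RatFunc.C k)) (hX : f RatFunc.X = g RatFunc.X) : f = g := by
  apply IsLocalization.ringHom_ext (nonZeroDivisors (Polynomial F))
  ext k
  · simpa using hC k
  · simpa using hX

theorem funField_ringHom_ext {L : Type*} [Field L] {f g : FunField →+* L}
    (hC : ∀ k, f (zEmb k) = g (zEmb k)) (hX : f tFun = g tFun) : f = g := by
  have h : f.comp ratEquiv.toRingHom = g.comp ratEquiv.toRingHom :=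
    ratFunc_ringHom_ext (by simpa using hC) (by simpa using hX)
  ext x
  obtain ⟨y, rfl⟩ := ratEquiv.surjective x
  exact congrArg (fun k => k y) h

/-- Transcendence of `t` in the degree that matters below: the fixed-point equation of a fractional
linear map is quadratic. -/
theorem eq_zero_of_quadratic {a b c : RatFunc ℂ}
    (h : zEmb a * tFun ^ 2 + zEmb b * tFun + zEmb c = 0) : a = 0 ∧ b = 0 ∧ c = 0 := by
  have := (injective_iff_map_eq_zero _).1 tFun_transcendental
    (Polynomial.C a * Polynomial.X ^ 2 + Polynomial.C b * Polynomial.X + Polynomial.C c)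
    (by simpa using h)
  refine ⟨?_, ?_, ?_⟩
  · simpa using congrArg (fun p => Polynomial.coeff p 2) this
  · simpa [Polynomial.coeff_X, Polynomial.coeff_C] using
      congrArg (fun p => Polynomial.coeff p 1) this
  · simpa [Polynomial.coeff_X] using congrArg (fun p => Polynomial.coeff p 0) this

end

section

/-! ## Automorphisms of `F(X)` over `F` -/

section RatFuncAut

variable {F : Type*} [Field F]

open IntermediateField

theorem ratFunc_linear_ne_zero {a b : F} (h : a ≠ 0 ∨ b ≠ 0) :
    RatFunc.C a * RatFunc.X + RatFunc.C b ≠ 0 := by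
  intro h0
  have h1 : algebraMap (Polynomial F) (RatFunc F) (Polynomial.C a * Polynomial.X + Polynomial.C b)
      = 0 := by simpa using h0
  rw [map_eq_zero_iff _ (RatFunc.algebraMap_injective F)] at h1
  have ha := congrArg (fun p => Polynomial.coeff p 1) h1
  have hb := congrArg (fun p => Polynomial.coeff p 0) h1
  simp [Polynomial.coeff_C] at ha hb
  exact h.elim (fun h => h ha) fun h => h hb

/-- The image `f` of `X` generates the whole field, and the degree of `F(X)` over `F(f)` is the
larger of the degrees of the numerator and denominator of `f`, so both are at most linear. A zero
determinant would make `f` constant, against injectivity. -/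
theorem ratFunc_aut_moebius (φ : RatFunc F ≃ₐ[F] RatFunc F) :
    ∃ a b c d : F, a * d - b * c ≠ 0 ∧ φ RatFunc.X =
      (RatFunc.C a * RatFunc.X + RatFunc.C b) / (RatFunc.C c * RatFunc.X + RatFunc.C d) := by
  set f := φ RatFunc.X with hf
  have htop : F⟮f⟯ = ⊤ := by
    have h1 := IntermediateField.adjoin_map F {(RatFunc.X : RatFunc F)} (φ : RatFunc F →ₐ[F] RatFunc F)
    rw [RatFunc.adjoin_X, Set.image_singleton] at h1
    rw [hf, ← AlgEquiv.coe_toAlgHom, ← h1, ← AlgHom.fieldRange_eq_map]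
    exact AlgHom.fieldRange_eq_top.2 φ.surjective
  have hdeg : max f.num.natDegree f.denom.natDegree = 1 := by
    rw [← RatFunc.finrank_eq_max_natDegree, IntermediateField.finrank_eq_one_iff_eq_top, htop]
  have hn := Polynomial.eq_X_add_C_of_natDegree_le_one (p := f.num) (by omega)
  have hd := Polynomial.eq_X_add_C_of_natDegree_le_one (p := f.denom) (by omega)
  have hfe : f = (RatFunc.C (f.num.coeff 1) * RatFunc.X + RatFunc.C (f.num.coeff 0)) /
      (RatFunc.C (f.denom.coeff 1) * RatFunc.X + RatFunc.C (f.denom.coeff 0)) := by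
    conv_lhs => rw [← RatFunc.num_div_denom f, hn, hd]
    simp
  refine ⟨_, _, _, _, ?_, hfe⟩
  generalize f.num.coeff 1 = a at *
  generalize f.num.coeff 0 = b at *
  have hcd : f.denom.coeff 1 ≠ 0 ∨ f.denom.coeff 0 ≠ 0 := by
    by_contra! h
    rw [h.1, h.2] at hd
    exact f.denom_ne_zero (by simpa using hd)
  generalize f.denom.coeff 1 = c at *
  generalize f.denom.coeff 0 = d at *
  intro h
  have hk : ∃ k, a = k * c ∧ b = k * d := by
    by_cases hc : c = 0
    · have hd0 : d ≠ 0 := by tauto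
      refine ⟨b / d, ?_, by field_simp⟩
      rw [hc] at h ⊢
      have : a * d = 0 := by linear_combination h
      simpa [hd0] using this
    · refine ⟨a / c, by field_simp, ?_⟩
      field_simp
      linear_combination -h
  obtain ⟨k, rfl, rfl⟩ := hk
  have hfk : f = RatFunc.C k := by
    rw [hfe, map_mul, map_mul, div_eq_iff (ratFunc_linear_ne_zero hcd)]
    ring
  have h2 : RatFunc.X = RatFunc.C k := by
    apply φ.injective
    rw [← hf, hfk, ← RatFunc.algebraMap_eq_C, φ.commutes]
  exact ratFunc_linear_ne_zero (a := (1 : F)) (b := -k) (Or.inl one_ne_zero) (by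
    rw [h2]; simp)

/-- A nonzero determinant makes the fraction nonconstant, hence transcendental, so it may be
substituted for `X`. -/
theorem exists_ratFunc_aut {a b c d : F} (h : a * d - b * c ≠ 0) :
    ∃ φ : RatFunc F ≃ₐ[F] RatFunc F, φ RatFunc.X =
      (RatFunc.C a * RatFunc.X + RatFunc.C b) / (RatFunc.C c * RatFunc.X + RatFunc.C d) := by
  set g := (RatFunc.C a * RatFunc.X + RatFunc.C b) / (RatFunc.C c * RatFunc.X + RatFunc.C d)
    with hg
  have hcd : c ≠ 0 ∨ d ≠ 0 := by
    by_contra! h'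
    rw [h'.1, h'.2] at h
    simp at h
  have hden := ratFunc_linear_ne_zero hcd
  have hgm : g * (RatFunc.C c * RatFunc.X + RatFunc.C d) =
      RatFunc.C a * RatFunc.X + RatFunc.C b := div_mul_cancel₀ _ hden
  have htr : Transcendental F g := by
    apply RatFunc.transcendental_of_ne_C
    rintro ⟨k, hk⟩
    rw [hk] at hgm
    have h1 : ¬ (a - k * c ≠ 0 ∨ b - k * d ≠ 0) := fun h' => ratFunc_linear_ne_zero h' (by
      simp only [map_sub, map_mul]
      linear_combination -hgm)
    push Not at h1
    exact h (by linear_combination d * h1.1 - c * h1.2)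
  have hinj : Function.Injective (Polynomial.aeval (R := F) g) :=
    transcendental_iff_injective.1 htr
  let φ : RatFunc F →ₐ[F] RatFunc F := RatFunc.liftAlgHom (Polynomial.aeval g)
    (nonZeroDivisors_le_comap_nonZeroDivisors_of_injective _ hinj)
  have hX : φ RatFunc.X = g := by
    have := RatFunc.liftAlgHom_apply_div (Polynomial.aeval (R := F) g)
      (nonZeroDivisors_le_comap_nonZeroDivisors_of_injective _ hinj) Polynomial.X 1
    simpa using! this
  have hC : ∀ k, φ (RatFunc.C k) = RatFunc.C k := fun k => by
    rw [← RatFunc.algebraMap_eq_C, φ.commutes]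
  have hne : RatFunc.C c * g - RatFunc.C a ≠ 0 := by
    intro h0
    have : RatFunc.C (a * d - b * c) = 0 := by
      simp only [map_sub, map_mul]
      linear_combination RatFunc.C c * hgm - (RatFunc.C c * RatFunc.X + RatFunc.C d) * h0
    exact h ((map_eq_zero RatFunc.C).1 this)
  have hsurj : Function.Surjective φ := by
    rw [← AlgHom.fieldRange_eq_top, eq_top_iff, ← RatFunc.adjoin_X, adjoin_simple_le_iff]
    -- This preimage of `X` comes from the adjugate matrix.
    refine ⟨(RatFunc.C b - RatFunc.C d * RatFunc.X) / (RatFunc.C c * RatFunc.X - RatFunc.C a), ?_⟩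
    change φ _ = _
    rw [map_div₀, map_sub, map_sub, map_mul, map_mul, hC, hC, hC, hC, hX, div_eq_iff hne]
    linear_combination -hgm
  exact ⟨AlgEquiv.ofBijective φ ⟨φ.injective, hsurj⟩, hX⟩

end RatFuncAut

/-! ## Fractional linear transformations of the function field -/

/-- The image of `x` under the fractional linear transformation with matrix `M`. -/
def mob (M : GL (Fin 2) (RatFunc ℂ)) (x : FunField) : FunField :=
  (zEmb (M 0 0) * x + zEmb (M 0 1)) / (zEmb (M 1 0) * x + zEmb (M 1 1))

theorem det_ne_zero' (M : GL (Fin 2) (RatFunc ℂ)) : M 0 0 * M 1 1 - M 0 1 * M 1 0 ≠ 0 := by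
  rw [← Matrix.det_fin_two]
  exact M.det_ne_zero

theorem linear_ne_zero {c d : RatFunc ℂ} (h : c ≠ 0 ∨ d ≠ 0) :
    zEmb c * tFun + zEmb d ≠ 0 := by
  intro h0
  obtain ⟨-, hc, hd⟩ := eq_zero_of_quadratic (a := 0) (b := c) (c := d) (by simpa using h0)
  exact h.elim (fun h => h hc) fun h => h hd

theorem mden_ne_zero (M : GL (Fin 2) (RatFunc ℂ)) : zEmb (M 1 0) * tFun + zEmb (M 1 1) ≠ 0 := by
  apply linear_ne_zero
  by_contra! h
  apply det_ne_zero' M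
  rw [h.1, h.2]
  simp

/-- Only the inner denominator has to be nonzero: the outer denominators of the two sides differ by
that factor and vanish together. -/
theorem moebius_comp {L : Type*} [Field L] {a b c d a' b' c' d' x : L} (h : c' * x + d' ≠ 0) :
    ((a * a' + b * c') * x + (a * b' + b * d')) / ((c * a' + d * c') * x + (c * b' + d * d')) =
      (a * ((a' * x + b') / (c' * x + d')) + b) / (c * ((a' * x + b') / (c' * x + d')) + d) := by
  have h1 : (a' * x + b') / (c' * x + d') * (c' * x + d') = a' * x + b' := div_mul_cancel₀ _ h
  rw [← mul_div_mul_right (a * ((a' * x + b') / (c' * x + d')) + b) _ h]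
  congr 1
  · linear_combination -a * h1
  · linear_combination -c * h1

theorem mob_mul (M N : GL (Fin 2) (RatFunc ℂ)) : mob (M * N) tFun = mob M (mob N tFun) := by
  have := moebius_comp (a := zEmb (M 0 0)) (b := zEmb (M 0 1)) (c := zEmb (M 1 0))
    (d := zEmb (M 1 1)) (a' := zEmb (N 0 0)) (b' := zEmb (N 0 1)) (mden_ne_zero N)
  simp only [← map_mul, ← map_add] at this
  simp only [mob, Units.val_mul, Matrix.mul_apply, Fin.sum_univ_two]
  exact this

theorem mk_eq_mk_of_smul {M N : GL (Fin 2) (RatFunc ℂ)} {k : RatFunc ℂ} (hk : k ≠ 0)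
    (h : ∀ i j, M i j * k = N i j) :
    Matrix.ProjGenLinGroup.mk M = Matrix.ProjGenLinGroup.mk N := by
  rw [Matrix.ProjGenLinGroup.mk_eq_mk_iff]
  refine ⟨Units.mk0 k hk, ?_⟩
  ext i j
  rw [← h i j]
  simp [Matrix.mul_apply, Matrix.diagonal_apply]

theorem exists_smul_of_mk_eq_mk {M N : GL (Fin 2) (RatFunc ℂ)}
    (h : Matrix.ProjGenLinGroup.mk M = Matrix.ProjGenLinGroup.mk N) :
    ∃ k : RatFunc ℂ, k ≠ 0 ∧ ∀ i j, M i j * k = N i j := by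
  rw [Matrix.ProjGenLinGroup.mk_eq_mk_iff] at h
  obtain ⟨u, rfl⟩ := h
  refine ⟨u, u.ne_zero, fun i j => ?_⟩
  simp [Matrix.mul_apply, Matrix.diagonal_apply]

theorem mob_eq_of_mk_eq {M N : GL (Fin 2) (RatFunc ℂ)}
    (h : Matrix.ProjGenLinGroup.mk M = Matrix.ProjGenLinGroup.mk N) (x : FunField) :
    mob M x = mob N x := by
  obtain ⟨k, hk, h⟩ := exists_smul_of_mk_eq_mk h
  have hk' : zEmb k ≠ 0 := by simpa using hk
  simp only [mob, ← h, map_mul]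
  rw [← mul_div_mul_right (zEmb (M 0 0) * x + zEmb (M 0 1)) _ hk']
  congr 1 <;> ring

@[simp]
theorem mob_one (x : FunField) : mob 1 x = x := by
  simp [mob]

theorem mk_eq_one_of_mob_eq {M : GL (Fin 2) (RatFunc ℂ)} (h : mob M tFun = tFun) :
    Matrix.ProjGenLinGroup.mk M = 1 := by
  rw [mob, div_eq_iff (mden_ne_zero M)] at h
  obtain ⟨h2, h1, h0⟩ := eq_zero_of_quadratic
    (a := - M 1 0) (b := M 0 0 - M 1 1) (c := M 0 1) (by
      simp only [map_sub, map_neg]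
      linear_combination h)
  have hM := det_ne_zero' M
  rw [neg_eq_zero] at h2
  rw [sub_eq_zero] at h1
  rw [h0, h1, h2] at hM
  have h11 : M 1 1 ≠ 0 := fun h => hM (by rw [h]; simp)
  rw [← map_one Matrix.ProjGenLinGroup.mk]
  apply mk_eq_mk_of_smul (inv_ne_zero h11)
  intro i j
  fin_cases i <;> fin_cases j
  · simpa [h1] using mul_inv_cancel₀ h11
  · simp [h0]
  · simp [h2]
  · simpa using mul_inv_cancel₀ h11

theorem mk_eq_of_mob_eq {M N : GL (Fin 2) (RatFunc ℂ)} (h : mob M tFun = mob N tFun) :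
    Matrix.ProjGenLinGroup.mk M = Matrix.ProjGenLinGroup.mk N := by
  have h1 : mob (N⁻¹ * M) tFun = tFun := by
    rw [mob_mul, h, ← mob_mul, inv_mul_cancel, mob_one]
  have h2 := mk_eq_one_of_mob_eq h1
  rw [map_mul, map_inv, inv_mul_eq_one] at h2
  exact h2.symm

/-! ## Birational maps preserving the fibration `z` -/

theorem algebraMap_eq_zEmb (c : ℂ) :
    algebraMap ℂ FunField c = zEmb (algebraMap _ _ (Polynomial.C c : Polynomial ℂ)) := by
  rw [zEmb_algebraMap, Polynomial.aeval_C, AlgHom.commutes]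

theorem zEmb_X : zEmb (algebraMap _ _ (Polynomial.X : Polynomial ℂ)) =
    ofPoly (MvPolynomial.X 2) := by
  rw [zEmb_algebraMap, Polynomial.aeval_X]

theorem map_zEmb_of_fixes (f : FunField ≃ₐ[ℂ] FunField)
    (h : f (ofPoly (MvPolynomial.X 2)) = ofPoly (MvPolynomial.X 2)) (k : RatFunc ℂ) :
    f (zEmb k) = zEmb k := by
  have : (f : FunField →+* FunField).comp (zEmb : RatFunc ℂ →+* FunField) = zEmb := by
    apply ratFunc_ringHom_ext
    · intro c
      rw [← RatFunc.algebraMap_C]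
      change f (zEmb _) = zEmb _
      rw [← algebraMap_eq_zEmb, AlgEquiv.commutes]
    · rw [← RatFunc.algebraMap_X]
      change f (zEmb _) = zEmb _
      rw [zEmb_X, h]
  exact congrArg (fun g => g k) this

theorem ratEquiv_moebius (a b c d : RatFunc ℂ) :
    ratEquiv ((RatFunc.C a * RatFunc.X + RatFunc.C b) / (RatFunc.C c * RatFunc.X + RatFunc.C d)) =
      (zEmb a * tFun + zEmb b) / (zEmb c * tFun + zEmb d) := by
  have hdiv : ∀ x y, ratEquiv (x / y) = ratHom x / ratHom y := fun x y => map_div₀ ratHom x y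
  rw [hdiv]
  simp only [map_add, map_mul, ratHom_C, ratHom_X]

theorem exists_mob_of_fixes (f : FunField ≃ₐ[ℂ] FunField)
    (h : f (ofPoly (MvPolynomial.X 2)) = ofPoly (MvPolynomial.X 2)) :
    ∃ M : GL (Fin 2) (RatFunc ℂ), f tFun = mob M tFun := by
  let φ : RatFunc (RatFunc ℂ) ≃+* RatFunc (RatFunc ℂ) :=
    (ratEquiv.trans f.toRingEquiv).trans ratEquiv.symm
  have hφ : ∀ x, ratEquiv (φ x) = f (ratEquiv x) := fun x => ratEquiv.apply_symm_apply _
  have hC : ∀ k, φ (RatFunc.C k) = RatFunc.C k := fun k => by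
    apply ratEquiv.injective
    rw [hφ, ratEquiv_C, map_zEmb_of_fixes f h]
  obtain ⟨a, b, c, d, hdet, hX⟩ := ratFunc_aut_moebius
    (AlgEquiv.ofRingEquiv (f := φ) (fun k => by rw [RatFunc.algebraMap_eq_C, hC]))
  refine ⟨Matrix.GeneralLinearGroup.mkOfDetNeZero !![a, b; c, d]
    (by simpa [Matrix.det_fin_two] using hdet), ?_⟩
  have h1 := hφ RatFunc.X
  change φ RatFunc.X = _ at hX
  rw [hX, ratEquiv_X] at h1
  rw [← h1, ratEquiv_moebius]
  rfl

theorem exists_aut_mob (M : GL (Fin 2) (RatFunc ℂ)) :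
    ∃ f : FunField ≃ₐ[ℂ] FunField, f tFun = mob M tFun ∧
      f (ofPoly (MvPolynomial.X 2)) = ofPoly (MvPolynomial.X 2) := by
  obtain ⟨φ, hφ⟩ := exists_ratFunc_aut (det_ne_zero' M)
  let g : FunField ≃+* FunField := (ratEquiv.symm.trans φ.toRingEquiv).trans ratEquiv
  have hg : ∀ x, g (ratEquiv x) = ratEquiv (φ x) := fun x => by
    change ratEquiv (φ (ratEquiv.symm (ratEquiv x))) = _
    rw [ratEquiv.symm_apply_apply]
  have hz : ∀ k, g (zEmb k) = zEmb k := fun k => by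
    rw [← ratEquiv_C, hg, ← RatFunc.algebraMap_eq_C, φ.commutes]
  refine ⟨AlgEquiv.ofRingEquiv (f := g) (fun c => by rw [algebraMap_eq_zEmb, hz]), ?_, ?_⟩
  · change g tFun = _
    rw [← ratEquiv_X, hg, hφ, ratEquiv_moebius, ratEquiv_X]
    rfl
  · change g _ = _
    rw [← zEmb_X, hz]

theorem algEquiv_ext_of_fixes {f g : FunField ≃ₐ[ℂ] FunField}
    (hf : f (ofPoly (MvPolynomial.X 2)) = ofPoly (MvPolynomial.X 2))
    (hg : g (ofPoly (MvPolynomial.X 2)) = ofPoly (MvPolynomial.X 2))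
    (h : f tFun = g tFun) : f = g := by
  have : (f : FunField →+* FunField) = g := funField_ringHom_ext
    (fun k => (map_zEmb_of_fixes f hf k).trans (map_zEmb_of_fixes g hg k).symm) h
  ext x
  exact congrArg (fun k => k x) this

end

section

open Matrix.ProjGenLinGroup (mk)
open MvPolynomial (eval)

/-! ## The real structure -/

theorem sigma_ofPoly (p : MvPolynomial (Fin 3) ℂ) : sigma (ofPoly p) = ofPoly (conjPoly p) :=
  IsFractionRing.ringEquivOfRingEquiv_algebraMap conjCoord (Ideal.Quotient.mk _ p)

@[simp]
theorem conjPoly_C (c : ℂ) : conjPoly (MvPolynomial.C c) = MvPolynomial.C (star c) := by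
  simp [conjPoly]

@[simp]
theorem conjPoly_X (i : Fin 3) : conjPoly (MvPolynomial.X i) = MvPolynomial.X i := by
  simp [conjPoly]

@[simp]
theorem conjPoly_conjPoly (p : MvPolynomial (Fin 3) ℂ) : conjPoly (conjPoly p) = p := by
  induction p using MvPolynomial.induction_on with
  | C a => simp
  | add p q hp hq => rw [map_add, map_add, hp, hq]
  | mul_X p i hp => rw [map_mul, map_mul, hp, conjPoly_X, conjPoly_X]

theorem sigma_X (i : Fin 3) : sigma (ofPoly (MvPolynomial.X i)) = ofPoly (MvPolynomial.X i) := by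
  rw [sigma_ofPoly, conjPoly_X]

@[simp]
theorem sigma_sigma (g : FunField) : sigma (sigma g) = g := by
  obtain ⟨u, v, -, rfl⟩ := exists_ofPoly_div g
  simp only [map_div₀, sigma_ofPoly, conjPoly_conjPoly]

theorem sigma_tFun : sigma tFun = uFun := by
  rw [tFun, sigma_ofPoly, uFun]
  simp

theorem conjRat_algebraMap (q : Polynomial ℂ) :
    conjRat (algebraMap _ _ q) = algebraMap _ _ (conjZ q) := by
  have := RatFunc.map_apply_div (R := ℂ) (φ := conjZ)
    (nonZeroDivisors_le_comap_nonZeroDivisors_of_injective _ conjZ_injective) q 1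
  simpa using! this

theorem sigma_zEmb (k : RatFunc ℂ) : sigma (zEmb k) = zEmb (conjRat k) := by
  have h : (sigma : FunField →+* FunField).comp (zEmb : RatFunc ℂ →+* FunField) =
      (zEmb : RatFunc ℂ →+* FunField).comp conjRat := by
    apply ratFunc_ringHom_ext
    · intro c
      rw [← RatFunc.algebraMap_C]
      change sigma (zEmb _) = zEmb (conjRat _)
      rw [conjRat_algebraMap, zEmb_algebraMap, zEmb_algebraMap, sigma_ofPoly]
      simp [conjZ, MvPolynomial.algebraMap_eq]
    · rw [← RatFunc.algebraMap_X]
      change sigma (zEmb _) = zEmb (conjRat _)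
      rw [conjRat_algebraMap, zEmb_algebraMap, zEmb_algebraMap, sigma_ofPoly]
      simp [conjZ]
  exact congrArg (fun g => g k) h

@[simp]
theorem conjZ_conjZ (q : Polynomial ℂ) : conjZ (conjZ q) = q := by
  simp only [conjZ, Polynomial.coe_mapRingHom, Polynomial.map_map]
  convert Polynomial.map_id
  ext x
  simp

@[simp]
theorem conjRat_conjRat (k : RatFunc ℂ) : conjRat (conjRat k) = k := by
  apply (zEmb : RatFunc ℂ →+* FunField).injective
  change zEmb _ = zEmb _
  rw [← sigma_zEmb, ← sigma_zEmb, sigma_sigma]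

@[simp]
theorem conjZ_hPoly : conjZ hPoly = hPoly := by
  simp [conjZ, hPoly]

/-- Conjugation of the coefficients of a matrix. -/
abbrev conjGL : GL (Fin 2) (RatFunc ℂ) →* GL (Fin 2) (RatFunc ℂ) :=
  Matrix.GeneralLinearGroup.map conjRat

theorem sigma_mob (M : GL (Fin 2) (RatFunc ℂ)) (x : FunField) :
    sigma (mob M x) = mob (conjGL M) (sigma x) := by
  simp only [mob, map_div₀, map_add, map_mul, sigma_zEmb]
  rfl

theorem mob_tauGL (x : FunField) : mob tauGL x = zEmb (algebraMap _ _ hPoly) / x := by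
  have h : ∀ i j, tauGL i j = (!![0, algebraMap (Polynomial ℂ) (RatFunc ℂ) hPoly; 1, 0] :
    Matrix (Fin 2) (Fin 2) (RatFunc ℂ)) i j := fun _ _ => rfl
  simp [mob, h]

theorem mob_tauGL_tFun : mob tauGL tFun = uFun := by
  rw [mob_tauGL, uFun_eq]

theorem tau_mul_tau : tau * tau = 1 := by
  rw [tau, ← map_mul]
  apply mk_eq_one_of_mob_eq
  rw [mob_mul, mob_tauGL_tFun, mob_tauGL, uFun_eq, div_div_cancel₀ zEmb_h_ne_zero]

/-! ## The correspondence between birational maps and classes of matrices -/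

theorem map_mob_of_fixes (f : FunField ≃ₐ[ℂ] FunField)
    (h : f (ofPoly (MvPolynomial.X 2)) = ofPoly (MvPolynomial.X 2))
    (M : GL (Fin 2) (RatFunc ℂ)) (x : FunField) : f (mob M x) = mob M (f x) := by
  simp only [mob, map_div₀, map_add, map_mul, map_zEmb_of_fixes f h]

theorem PsiConj.unique {f : BirC} {A B : PGL(2, RatFunc ℂ)} (hA : PsiConj f A)
    (hB : PsiConj f B) : A = B := by
  obtain ⟨M, rfl, h1, -⟩ := hA
  obtain ⟨N, rfl, h2, -⟩ := hB
  exact mk_eq_of_mob_eq (h1.symm.trans h2)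

theorem PsiConj.unop_tFun {f : BirC} {M : GL (Fin 2) (RatFunc ℂ)} (h : PsiConj f (mk M)) :
    f.unop tFun = mob M tFun := by
  obtain ⟨N, hN, h1, -⟩ := h
  exact h1.trans (mob_eq_of_mk_eq hN tFun)

theorem PsiConj.unop_z {f : BirC} {A : PGL(2, RatFunc ℂ)} (h : PsiConj f A) :
    f.unop (ofPoly (MvPolynomial.X 2)) = ofPoly (MvPolynomial.X 2) := h.choose_spec.2.2

theorem PsiConj.injective {f g : BirC} {A : PGL(2, RatFunc ℂ)} (hf : PsiConj f A)
    (hg : PsiConj g A) : f = g := by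
  obtain ⟨M, rfl⟩ := Matrix.ProjGenLinGroup.mk_surjective A
  exact MulOpposite.unop_injective (algEquiv_ext_of_fixes hf.unop_z hg.unop_z
    (hf.unop_tFun.trans hg.unop_tFun.symm))

/-- Comorphisms reverse composition, but each one fixes the coefficients in `ℂ(z)` and only
substitutes for `t`, which reverses the order again. Hence the matrices multiply in the order of the
maps. -/
theorem PsiConj.mul {f g : BirC} {A B : PGL(2, RatFunc ℂ)} (hf : PsiConj f A)
    (hg : PsiConj g B) : PsiConj (f * g) (A * B) := by
  have hfz := hf.unop_z
  have hgz := hg.unop_z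
  obtain ⟨M, rfl⟩ := Matrix.ProjGenLinGroup.mk_surjective A
  obtain ⟨N, rfl⟩ := Matrix.ProjGenLinGroup.mk_surjective B
  refine ⟨M * N, map_mul _ _ _, ?_, ?_⟩
  · change g.unop (f.unop tFun) = mob (M * N) tFun
    rw [hf.unop_tFun, map_mob_of_fixes _ hgz, hg.unop_tFun, mob_mul]
  · change g.unop (f.unop _) = _
    rw [hfz, hgz]

theorem psiConj_one : PsiConj 1 1 :=
  ⟨1, map_one _, (mob_one tFun).symm, rfl⟩

theorem exists_psiConj_left (A : PGL(2, RatFunc ℂ)) : ∃ f : BirC, PsiConj f A := by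
  obtain ⟨M, rfl⟩ := Matrix.ProjGenLinGroup.mk_surjective A
  obtain ⟨f, h1, h2⟩ := exists_aut_mob M
  exact ⟨MulOpposite.op f, M, rfl, h1, h2⟩

theorem exists_psiConj_right {f : BirC}
    (h : f.unop (ofPoly (MvPolynomial.X 2)) = ofPoly (MvPolynomial.X 2)) : ∃ A, PsiConj f A := by
  obtain ⟨M, hM⟩ := exists_mob_of_fixes f.unop h
  exact ⟨mk M, M, rfl, hM, h⟩

theorem PsiConj.inv {f : BirC} {A : PGL(2, RatFunc ℂ)} (hf : PsiConj f A) :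
    PsiConj f⁻¹ A⁻¹ := by
  obtain ⟨g, hg⟩ := exists_psiConj_left A⁻¹
  have h := hf.mul hg
  rw [mul_inv_cancel] at h
  rwa [← eq_inv_of_mul_eq_one_right (h.injective psiConj_one)]

theorem mem_scriptG_iff (M : GL (Fin 2) (RatFunc ℂ)) :
    mk M ∈ scriptG ↔ mk (tauGL * M) = mk (conjGL M * tauGL) := by
  change tau * mk M * tau = mk (conjGL M) ↔ _
  rw [map_mul, map_mul]
  change _ ↔ tau * _ = _ * tau
  constructor
  · intro h
    rw [← h, mul_assoc _ tau tau, tau_mul_tau, mul_one]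
  · intro h
    rw [h, mul_assoc, tau_mul_tau, mul_one]

/-- Both composites with `σ` agree on `ℂ(z)`, so only their values on `t` matter. Because `σ(t) = τ
· t`, these are given by the matrices `τM` and `M̄τ`. -/
theorem PsiConj.mem_birS_iff {f : BirC} {A : PGL(2, RatFunc ℂ)} (hf : PsiConj f A) :
    f ∈ birS ↔ A ∈ scriptG := by
  have hz := hf.unop_z
  obtain ⟨M, rfl⟩ := Matrix.ProjGenLinGroup.mk_surjective A
  have ht := hf.unop_tFun
  have h1 : f.unop (sigma tFun) = mob (tauGL * M) tFun := by
    rw [sigma_tFun, ← mob_tauGL_tFun, map_mob_of_fixes _ hz, ht, mob_mul]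
  have h2 : sigma (f.unop tFun) = mob (conjGL M * tauGL) tFun := by
    rw [ht, sigma_mob, sigma_tFun, mob_mul, mob_tauGL_tFun]
  rw [mem_scriptG_iff]
  constructor
  · intro h
    apply mk_eq_of_mob_eq
    rw [← h1, ← h2]
    exact h tFun
  · intro h
    have key : (f.unop : FunField →+* FunField).comp (sigma : FunField →+* FunField) =
        (sigma : FunField →+* FunField).comp (f.unop : FunField →+* FunField) := by
      apply funField_ringHom_ext
      · intro k
        change f.unop (sigma _) = sigma (f.unop _)
        rw [sigma_zEmb, map_zEmb_of_fixes _ hz, map_zEmb_of_fixes _ hz, sigma_zEmb]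
      · change f.unop (sigma _) = sigma (f.unop _)
        rw [h1, h2, mob_eq_of_mk_eq h]
    exact fun g => congrArg (fun k => k g) key

theorem PsiConj.mem_birOver_iff {f : BirC} {A : PGL(2, RatFunc ℂ)} (hf : PsiConj f A) :
    f ∈ birOver ↔ A ∈ scriptG := by
  rw [← hf.mem_birS_iff]
  exact ⟨fun h => h.1, fun h => ⟨h, hf.unop_z⟩⟩

theorem exists_mulEquiv_of_psiImage (G : Subgroup BirC) (H : Subgroup (PGL(2, RatFunc ℂ)))
    (hG : ∀ f ∈ G, f ∈ birOver) (hH : (H : Set (PGL(2, RatFunc ℂ))) = psiImage G) :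
    ∃ Θ : G ≃* H, ∀ f : G, PsiConj (f : BirC) (Θ f : PGL(2, RatFunc ℂ)) := by
  have hex : ∀ f : G, ∃ A : H, PsiConj (f : BirC) A := by
    intro f
    obtain ⟨A, hA⟩ := exists_psiConj_right (hG f f.2).2
    have : A ∈ (H : Set (PGL(2, RatFunc ℂ))) := by
      rw [hH]
      exact ⟨f, f.2, hA⟩
    exact ⟨⟨A, this⟩, hA⟩
  choose θ hθ using hex
  let Φ : G →* H := MonoidHom.mk' θ fun f g => Subtype.ext
    ((hθ (f * g)).unique ((hθ f).mul (hθ g)))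
  refine ⟨MulEquiv.ofBijective Φ ⟨?_, ?_⟩, hθ⟩
  · intro f g hfg
    have h : θ f = θ g := hfg
    exact Subtype.ext ((h ▸ hθ f).injective (hθ g))
  · intro A
    have hA : (A : PGL(2, RatFunc ℂ)) ∈ (H : Set (PGL(2, RatFunc ℂ))) := A.2
    rw [hH] at hA
    obtain ⟨f, hf, hfA⟩ := hA
    exact ⟨⟨f, hf⟩, Subtype.ext ((hθ ⟨f, hf⟩).unique hfA)⟩

/-- `PsiConj` is a multiplicative bijective correspondence on maps over the `z`-line, so closure
properties can be proved for matrices and transported back. -/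
theorem exists_subgroup_of_psiImage (H : Subgroup (PGL(2, RatFunc ℂ))) (X : Set BirC)
    (hX : ∀ f ∈ X, f ∈ birOver) (hH : (H : Set (PGL(2, RatFunc ℂ))) = psiImage X) :
    ∃ G : Subgroup BirC, (G : Set BirC) = X := by
  have hiff : ∀ {f A}, PsiConj f A → (A ∈ H ↔ f ∈ X) := by
    intro f A hA
    rw [← SetLike.mem_coe, hH]
    constructor
    · rintro ⟨g, hg, hgA⟩
      rwa [hA.injective hgA]
    · intro hf
      exact ⟨f, hf, hA⟩
  have hex : ∀ f ∈ X, ∃ A ∈ H, PsiConj f A := by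
    intro f hf
    obtain ⟨A, hA⟩ := exists_psiConj_right (hX f hf).2
    exact ⟨A, (hiff hA).2 hf, hA⟩
  refine ⟨⟨⟨⟨X, ?_⟩, ?_⟩, ?_⟩, rfl⟩
  · intro f g hf hg
    obtain ⟨A, hA, hfA⟩ := hex f hf
    obtain ⟨B, hB, hgB⟩ := hex g hg
    exact (hiff (hfA.mul hgB)).1 (mul_mem hA hB)
  · exact (hiff psiConj_one).1 H.one_mem
  · intro f hf
    obtain ⟨A, hA, hfA⟩ := hex f hf
    exact (hiff hfA.inv).1 (inv_mem hA)

end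

section

open Matrix.ProjGenLinGroup (mk)
open Polynomial (C X)

/-! ## Normal form of the elements of `𝒢` -/

/-- The class `A` is represented by the matrix `[[a, b h], [b̄, ā]]`. -/
def IsStd (A : PGL(2, RatFunc ℂ)) (a b : Polynomial ℂ) : Prop :=
  ∃ M : GL (Fin 2) (RatFunc ℂ), mk M = A ∧
    (M : Matrix (Fin 2) (Fin 2) (RatFunc ℂ)) =
      !![algebraMap (Polynomial ℂ) (RatFunc ℂ) a, algebraMap (Polynomial ℂ) (RatFunc ℂ) (b * hPoly);
        algebraMap (Polynomial ℂ) (RatFunc ℂ) (conjZ b),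
        algebraMap (Polynomial ℂ) (RatFunc ℂ) (conjZ a)]

/-- The determinant `a ā - b b̄ h` as a function on the real line. -/
def detFun (a b : Polynomial ℂ) (r : ℝ) : ℝ :=
  Complex.normSq (a.eval (r : ℂ)) - Complex.normSq (b.eval (r : ℂ)) * (1 - r ^ 2)

theorem eval_conjZ (q : Polynomial ℂ) (r : ℝ) :
    (conjZ q).eval (r : ℂ) = starRingEnd ℂ (q.eval (r : ℂ)) := by
  have := Polynomial.eval_map_apply (f := starRingEnd ℂ) (p := q) (r : ℂ)
  rw [Complex.conj_ofReal] at this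
  exact this

theorem eval_hPoly (r : ℝ) : hPoly.eval (r : ℂ) = ((1 - r ^ 2 : ℝ) : ℂ) := by
  simp [hPoly]

theorem exists_real_of_conjZ_eq {q : Polynomial ℂ} (h : conjZ q = q) :
    ∃ D : Polynomial ℝ, D.map (algebraMap ℝ ℂ) = q := by
  rw [← Polynomial.mem_lifts, Polynomial.lifts_iff_coeff_lifts]
  intro n
  refine ⟨(q.coeff n).re, ?_⟩
  have : starRingEnd ℂ (q.coeff n) = q.coeff n := by
    conv_rhs => rw [← h]
    simp [conjZ]
  exact Complex.conj_eq_iff_re.1 this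

theorem eval_det (a b : Polynomial ℂ) (r : ℝ) :
    (a * conjZ a - b * conjZ b * hPoly).eval (r : ℂ) = (detFun a b r : ℂ) := by
  simp only [Polynomial.eval_sub, Polynomial.eval_mul, eval_conjZ, eval_hPoly, detFun,
    Complex.mul_conj]
  push_cast
  ring

/-- The determinant equals its own conjugate, so it automatically comes from a real polynomial, and
only its values on the real line need be tracked. -/
theorem mem_explicitH0_iff (A : PGL(2, RatFunc ℂ)) :
    A ∈ explicitH0 ↔ ∃ a b, (∀ r, 0 < detFun a b r) ∧ IsStd A a b := by
  have key : ∀ (a b : Polynomial ℂ) (D : Polynomial ℝ),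
      D.map (algebraMap ℝ ℂ) = a * conjZ a - b * conjZ b * hPoly → ∀ r, D.eval r = detFun a b r := by
    intro a b D hD r
    have h1 := eval_det a b r
    rw [← hD] at h1
    have h2 := Polynomial.eval_map_apply (f := algebraMap ℝ ℂ) (p := D) r
    exact Complex.ofReal_injective (h2.symm.trans h1)
  constructor
  · rintro ⟨a, b, ⟨D, hD, hDe⟩, hM⟩
    exact ⟨a, b, fun r => key a b D hDe r ▸ hD r, hM⟩
  · rintro ⟨a, b, hpos, hM⟩
    obtain ⟨D, hD⟩ := exists_real_of_conjZ_eq (q := a * conjZ a - b * conjZ b * hPoly)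
      (by simp only [map_sub, map_mul, conjZ_conjZ, conjZ_hPoly]; ring)
    exact ⟨a, b, ⟨D, fun r => by rw [key a b D hD]; exact hpos r, hD⟩, hM⟩

theorem gl_ext_entries {M : GL (Fin 2) (RatFunc ℂ)} {a b c d : RatFunc ℂ} (h00 : M 0 0 = a)
    (h01 : M 0 1 = b) (h10 : M 1 0 = c) (h11 : M 1 1 = d) :
    (M : Matrix (Fin 2) (Fin 2) (RatFunc ℂ)) = !![a, b; c, d] := by
  ext i j
  fin_cases i <;> fin_cases j
  exacts [h00, h01, h10, h11]

theorem isStd_of_smul {M : GL (Fin 2) (RatFunc ℂ)} {a b : Polynomial ℂ} {k : RatFunc ℂ}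
    (hk : k ≠ 0) (h00 : M 0 0 * k = algebraMap _ _ a) (h01 : M 0 1 * k = algebraMap _ _ (b * hPoly))
    (h10 : M 1 0 * k = algebraMap _ _ (conjZ b)) (h11 : M 1 1 * k = algebraMap _ _ (conjZ a)) :
    IsStd (mk M) a b := by
  have hent : ∀ i j, (M * Matrix.GeneralLinearGroup.scalar (Fin 2) (Units.mk0 k hk)) i j =
      M i j * k := fun i j => by simp [Matrix.mul_apply, Matrix.diagonal_apply]
  refine ⟨M * Matrix.GeneralLinearGroup.scalar (Fin 2) (Units.mk0 k hk), ?_, ?_⟩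
  · rw [map_mul, Matrix.ProjGenLinGroup.mk_scalar, mul_one]
  · apply gl_ext_entries <;> rw [hent]
    exacts [h00, h01, h10, h11]

theorem isStd_of_entries {M : GL (Fin 2) (RatFunc ℂ)} {a b : Polynomial ℂ}
    (h00 : M 0 0 = algebraMap _ _ a) (h01 : M 0 1 = algebraMap _ _ (b * hPoly))
    (h10 : M 1 0 = algebraMap _ _ (conjZ b)) (h11 : M 1 1 = algebraMap _ _ (conjZ a)) :
    IsStd (mk M) a b := ⟨M, rfl, gl_ext_entries h00 h01 h10 h11⟩

theorem IsStd.exists_entries {A : PGL(2, RatFunc ℂ)} {a b : Polynomial ℂ} (h : IsStd A a b) :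
    ∃ M : GL (Fin 2) (RatFunc ℂ), mk M = A ∧ M 0 0 = algebraMap _ _ a ∧
      M 0 1 = algebraMap _ _ (b * hPoly) ∧ M 1 0 = algebraMap _ _ (conjZ b) ∧
      M 1 1 = algebraMap _ _ (conjZ a) := by
  obtain ⟨M, hM, h⟩ := h
  refine ⟨M, hM, ?_, ?_, ?_, ?_⟩ <;> rw [h] <;> rfl

theorem gl_mul_entry (M N : GL (Fin 2) (RatFunc ℂ)) (i j : Fin 2) :
    (M * N) i j = M i 0 * N 0 j + M i 1 * N 1 j := by
  simp [Matrix.mul_apply, Fin.sum_univ_two]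

theorem tauGL_00 : tauGL 0 0 = 0 := rfl
theorem tauGL_01 : tauGL 0 1 = algebraMap _ _ hPoly := rfl
theorem tauGL_10 : tauGL 1 0 = 1 := rfl
theorem tauGL_11 : tauGL 1 1 = 0 := rfl

theorem conjGL_entry (M : GL (Fin 2) (RatFunc ℂ)) (i j : Fin 2) :
    conjGL M i j = conjRat (M i j) := rfl

theorem isStd_one : IsStd 1 1 0 := by
  rw [← map_one mk]
  apply isStd_of_entries <;> simp

theorem IsStd.mul {A B : PGL(2, RatFunc ℂ)} {a b c d : Polynomial ℂ} (hA : IsStd A a b)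
    (hB : IsStd B c d) : IsStd (A * B) (a * c + b * conjZ d * hPoly) (a * d + b * conjZ c) := by
  obtain ⟨M, rfl, hM⟩ := hA.exists_entries
  obtain ⟨N, rfl, hN⟩ := hB.exists_entries
  rw [← map_mul]
  apply isStd_of_entries <;> rw [gl_mul_entry] <;>
    simp only [hM, hN, map_mul, map_add, conjZ_conjZ, conjZ_hPoly] <;> ring

theorem detFun_mul (a b c d : Polynomial ℂ) (r : ℝ) :
    detFun (a * c + b * conjZ d * hPoly) (a * d + b * conjZ c) r = detFun a b r * detFun c d r := by
  apply Complex.ofReal_injective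
  rw [Complex.ofReal_mul, ← eval_det, ← eval_det, ← eval_det, ← Polynomial.eval_mul]
  congr 1
  simp only [map_mul, map_add, conjZ_conjZ, conjZ_hPoly]
  ring

theorem IsStd.inv {A : PGL(2, RatFunc ℂ)} {a b : Polynomial ℂ} (hA : IsStd A a b) :
    IsStd A⁻¹ (conjZ a) (-b) := by
  obtain ⟨M, rfl, h00, h01, h10, h11⟩ := hA.exists_entries
  have hd := det_ne_zero' M
  -- The adjugate, which is again of standard form.
  let N : GL (Fin 2) (RatFunc ℂ) := Matrix.GeneralLinearGroup.mkOfDetNeZero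
    !![M 1 1, -M 0 1; -M 1 0, M 0 0] (by
      rw [Matrix.det_fin_two_of]
      intro h
      exact hd (by linear_combination h))
  have n00 : N 0 0 = M 1 1 := rfl
  have n01 : N 0 1 = - M 0 1 := rfl
  have n10 : N 1 0 = - M 1 0 := rfl
  have n11 : N 1 1 = M 0 0 := rfl
  have hN : IsStd (mk N) (conjZ a) (-b) := by
    apply isStd_of_entries
    · rw [n00, h11]
    · rw [n01, h01, ← map_neg, neg_mul]
    · rw [n10, h10, ← map_neg, ← map_neg]
    · rw [n11, h00, conjZ_conjZ]
  have h1 : mk (M * N) = mk 1 := by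
    apply mk_eq_mk_of_smul (inv_ne_zero hd)
    intro i j
    rw [gl_mul_entry]
    have hc := mul_inv_cancel₀ hd
    fin_cases i <;> fin_cases j <;> simp only [Fin.zero_eta, Fin.mk_one, n00, n01, n10, n11]
    · simp only [Units.val_one, Matrix.one_apply_eq]
      linear_combination hc
    · simp only [Units.val_one, ne_eq, zero_ne_one, not_false_eq_true, Matrix.one_apply_ne]
      ring
    · simp only [Units.val_one, ne_eq, one_ne_zero, not_false_eq_true, Matrix.one_apply_ne]
      ring
    · simp only [Units.val_one, Matrix.one_apply_eq]
      linear_combination hc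
  rw [map_mul, map_one] at h1
  rwa [← eq_inv_of_mul_eq_one_right h1]

theorem detFun_inv (a b : Polynomial ℂ) (r : ℝ) : detFun (conjZ a) (-b) r = detFun a b r := by
  simp [detFun, eval_conjZ, Complex.normSq_conj, Complex.normSq_neg]

/-- For a standard matrix `τM = M̄τ` holds exactly, with no scalar. -/
theorem IsStd.mem_scriptG {A : PGL(2, RatFunc ℂ)} {a b : Polynomial ℂ} (hA : IsStd A a b) :
    A ∈ scriptG := by
  obtain ⟨M, rfl, h00, h01, h10, h11⟩ := hA.exists_entries
  rw [mem_scriptG_iff]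
  congr 1
  ext i j
  rw [gl_mul_entry, gl_mul_entry]
  fin_cases i <;> fin_cases j <;>
  simp only [Fin.zero_eta, Fin.mk_one, tauGL_00, tauGL_01, tauGL_10, tauGL_11, conjGL_entry, h00,
    h01, h10, h11, conjRat_algebraMap, conjZ_conjZ, map_mul, conjZ_hPoly] <;> ring

/-- When `h` divides the diagonal, every entry of the product with `τ` is divisible by `h`, and
cancelling `h` restores the standard form. -/
theorem IsStd.tau_mul_of_dvd {A : PGL(2, RatFunc ℂ)} {a b : Polynomial ℂ}
    (hA : IsStd A (a * hPoly) b) : IsStd (tau * A) (conjZ b) (conjZ a) := by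
  obtain ⟨M, rfl, h00, h01, h10, h11⟩ := hA.exists_entries
  rw [tau, ← map_mul]
  have hh : algebraMap (Polynomial ℂ) (RatFunc ℂ) hPoly ≠ 0 := by simpa using hPoly_ne_zero
  apply isStd_of_smul (inv_ne_zero hh) <;> rw [gl_mul_entry] <;>
    simp only [tauGL_00, tauGL_01, tauGL_10, tauGL_11, h00, h01, h10, h11, map_mul, conjZ_conjZ,
      conjZ_hPoly] <;> field_simp <;> ring

theorem IsStd.conj {A : PGL(2, RatFunc ℂ)} {a b : Polynomial ℂ} (hA : IsStd A a b) :
    IsStd (tau * A * tau) (conjZ a) (conjZ b) := by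
  have h : tau * A * tau = _ := hA.mem_scriptG
  rw [h]
  obtain ⟨M, rfl, h00, h01, h10, h11⟩ := hA.exists_entries
  change IsStd (mk (conjGL M)) _ _
  apply isStd_of_entries <;> rw [conjGL_entry] <;>
    simp only [h00, h01, h10, h11, conjRat_algebraMap, map_mul, conjZ_hPoly]

theorem detFun_conj (a b : Polynomial ℂ) (r : ℝ) :
    detFun (conjZ a) (conjZ b) r = detFun a b r := by
  simp [detFun, eval_conjZ, Complex.normSq_conj]

/-- Each common real root contributes a factor `X - r` with real coefficients, so dividing it out
preserves the standard form. A full gcd need not be self-conjugate. -/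
theorem exists_eq_mul_no_common_real_root (a b : Polynomial ℂ) (h : a ≠ 0 ∨ b ≠ 0) :
    ∃ R a' b' : Polynomial ℂ, R ≠ 0 ∧ conjZ R = R ∧ a = R * a' ∧ b = R * b' ∧
      ∀ r : ℝ, a'.eval (r : ℂ) ≠ 0 ∨ b'.eval (r : ℂ) ≠ 0 := by
  induction hn : a.natDegree + b.natDegree using Nat.strong_induction_on generalizing a b with
  | _ n ih =>
    by_cases hr : ∃ r : ℝ, a.eval (r : ℂ) = 0 ∧ b.eval (r : ℂ) = 0
    · obtain ⟨r, ha, hb⟩ := hr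
      obtain ⟨a₁, rfl⟩ := Polynomial.dvd_iff_isRoot.2 ha
      obtain ⟨b₁, rfl⟩ := Polynomial.dvd_iff_isRoot.2 hb
      have hX : (X - C (r : ℂ)) ≠ 0 := Polynomial.X_sub_C_ne_zero _
      have h1 : a₁ ≠ 0 ∨ b₁ ≠ 0 := h.imp right_ne_zero_of_mul right_ne_zero_of_mul
      have hlt : a₁.natDegree + b₁.natDegree < n := by
        have hle : ∀ q : Polynomial ℂ, q.natDegree ≤ ((X - C (r : ℂ)) * q).natDegree := by
          intro q
          by_cases hq : q = 0
          · simp [hq]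
          · rw [Polynomial.natDegree_mul hX hq]; omega
        have hlt' : ∀ q : Polynomial ℂ, q ≠ 0 →
            q.natDegree < ((X - C (r : ℂ)) * q).natDegree := by
          intro q hq
          rw [Polynomial.natDegree_mul hX hq, Polynomial.natDegree_X_sub_C]; omega
        rw [← hn]
        rcases h1 with h1 | h1
        · exact add_lt_add_of_lt_of_le (hlt' _ h1) (hle _)
        · exact add_lt_add_of_le_of_lt (hle _) (hlt' _ h1)
      obtain ⟨R, a', b', hR, hRc, rfl, rfl, hab⟩ := ih _ hlt a₁ b₁ h1 rfl
      refine ⟨(X - C (r : ℂ)) * R, a', b', mul_ne_zero hX hR, ?_, by ring, by ring, hab⟩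
      rw [map_mul, hRc]
      simp [conjZ]
    · push Not at hr
      refine ⟨1, a, b, one_ne_zero, map_one _, by simp, by simp, fun r => ?_⟩
      by_cases ha : a.eval (r : ℂ) = 0
      · exact Or.inr (hr r ha)
      · exact Or.inl ha

/-- The element `m = 1 + l` works unless it is zero; for `l = -1` take `m = i`. -/
theorem hilbert_ninety {l : RatFunc ℂ} (h : l * conjRat l = 1) :
    ∃ m : RatFunc ℂ, m ≠ 0 ∧ conjRat m * l = m := by
  by_cases hl : 1 + l = 0
  · have hC : conjRat (algebraMap _ _ (C Complex.I)) = - algebraMap _ _ (C Complex.I) := by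
      rw [conjRat_algebraMap, ← map_neg]
      simp [conjZ]
    refine ⟨algebraMap (Polynomial ℂ) _ (C Complex.I), ?_, ?_⟩
    · rw [Ne, map_eq_zero_iff _ (RatFunc.algebraMap_injective ℂ)]
      simp
    · rw [hC, eq_neg_of_add_eq_zero_right hl]
      ring
  · refine ⟨1 + l, hl, ?_⟩
    rw [map_add, map_one]
    linear_combination h

/-- A common denominator multiplied by its conjugate is self-conjugate. -/
theorem exists_real_denominator (k l : RatFunc ℂ) :
    ∃ N a b : Polynomial ℂ, N ≠ 0 ∧ conjZ N = N ∧ k * algebraMap _ _ N = algebraMap _ _ a ∧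
      l * algebraMap _ _ N = algebraMap _ _ b := by
  have hk := k.denom_ne_zero
  have hl := l.denom_ne_zero
  have hc : ∀ q : Polynomial ℂ, q ≠ 0 → conjZ q ≠ 0 := fun q hq =>
    (map_ne_zero_iff _ conjZ_injective).2 hq
  have key : ∀ x : RatFunc ℂ, x * algebraMap _ _ x.denom = algebraMap _ _ x.num := by
    intro x
    conv_lhs => rw [← RatFunc.num_div_denom x]
    rw [RatFunc.num_div_denom x]
    nth_rw 1 [← RatFunc.num_div_denom x]
    exact div_mul_cancel₀ _ (RatFunc.algebraMap_ne_zero x.denom_ne_zero)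
  refine ⟨k.denom * l.denom * (conjZ k.denom * conjZ l.denom),
    k.num * l.denom * (conjZ k.denom * conjZ l.denom),
    l.num * k.denom * (conjZ k.denom * conjZ l.denom),
    mul_ne_zero (mul_ne_zero hk hl) (mul_ne_zero (hc _ hk) (hc _ hl)), ?_, ?_, ?_⟩
  · simp only [map_mul, conjZ_conjZ]; ring
  · simp only [map_mul]
    linear_combination algebraMap _ (RatFunc ℂ) l.denom * (algebraMap _ _ (conjZ k.denom) *
      algebraMap _ _ (conjZ l.denom)) * key k
  · simp only [map_mul]
    linear_combination algebraMap _ (RatFunc ℂ) k.denom * (algebraMap _ _ (conjZ k.denom) *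
      algebraMap _ _ (conjZ l.denom)) * key l

/-- Membership in `𝒢` gives `τM` and `M̄τ` equal up to a scalar `l` of norm one. Hilbert 90 absorbs
`l` into a rescaling of `M`, after which denominators and common real roots are removed by
self-conjugate factors. -/
theorem exists_isStd_of_mem_scriptG {A : PGL(2, RatFunc ℂ)} (hA : A ∈ scriptG) :
    ∃ a b : Polynomial ℂ, (∀ r : ℝ, a.eval (r : ℂ) ≠ 0 ∨ b.eval (r : ℂ) ≠ 0) ∧ IsStd A a b := by
  obtain ⟨M, rfl⟩ := Matrix.ProjGenLinGroup.mk_surjective A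
  rw [mem_scriptG_iff] at hA
  obtain ⟨l, hl, hl'⟩ := exists_smul_of_mk_eq_mk hA
  have e00 := hl' 0 0
  have e01 := hl' 0 1
  have e10 := hl' 1 0
  have e11 := hl' 1 1
  have hdet := det_ne_zero' M
  simp only [gl_mul_entry, conjGL_entry, tauGL_00, tauGL_01, tauGL_10, tauGL_11] at e00 e01 e10 e11
  have hh : algebraMap (Polynomial ℂ) (RatFunc ℂ) hPoly ≠ 0 := by simpa using hPoly_ne_zero
  have hhc : conjRat (algebraMap (Polynomial ℂ) (RatFunc ℂ) hPoly) = algebraMap _ _ hPoly := by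
    rw [conjRat_algebraMap, conjZ_hPoly]
  generalize hη : algebraMap (Polynomial ℂ) (RatFunc ℂ) hPoly = η at *
  generalize hα : M 0 0 = α at *
  generalize hβ : M 0 1 = β at *
  generalize hγ : M 1 0 = γ at *
  generalize hδ : M 1 1 = δ at *
  have f10 : conjRat δ = α * l := by linear_combination -e10
  have f01 : conjRat α = δ * l := mul_right_cancel₀ hh (by linear_combination -e01)
  have f00 : conjRat β = η * γ * l := by linear_combination -e00
  have f11 : conjRat γ * η = β * l := by linear_combination -e11
  have hll : l * conjRat l = 1 := by
    have h1 := congrArg conjRat f01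
    have h2 := congrArg conjRat f00
    simp only [map_mul, conjRat_conjRat, hhc] at h1 h2
    rw [f10] at h1
    have h3 : β = β * l * conjRat l := by rw [← f11, h2]; ring
    -- Conjugating twice gives `α = α l l̄` and `β = β l l̄`; the first row of an invertible matrix
    -- has a nonzero entry to cancel.
    by_cases hα0 : α = 0
    · have hβ0 : β ≠ 0 := fun h => hdet (by rw [h, hα0]; ring)
      exact mul_left_cancel₀ hβ0 (by linear_combination -h3)
    · exact mul_left_cancel₀ hα0 (by linear_combination -h1)
  obtain ⟨m, hm, hml⟩ := hilbert_ninety hll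
  obtain ⟨N, a, c, hN, hNc, ha, hc⟩ := exists_real_denominator (α * m) (γ * m)
  have hNc' : conjRat (algebraMap _ _ N) = algebraMap _ _ N := by rw [conjRat_algebraMap, hNc]
  have hN0 : algebraMap (Polynomial ℂ) (RatFunc ℂ) N ≠ 0 := RatFunc.algebraMap_ne_zero hN
  have hac : a ≠ 0 ∨ conjZ c ≠ 0 := by
    by_contra! h
    rw [map_eq_zero_iff _ conjZ_injective] at h
    rw [h.1, map_zero] at ha
    rw [h.2, map_zero] at hc
    have h1 : α = 0 := by simpa [hm, hN0] using ha
    have h2 : γ = 0 := by simpa [hm, hN0] using hc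
    exact hdet (by rw [h1, h2]; ring)
  -- The first column determines everything: `b` is the conjugate of the lower left entry, and the
  -- second column follows by conjugation.
  obtain ⟨R, a', b', hR, hRc, rfl, hb', hab⟩ := exists_eq_mul_no_common_real_root a (conjZ c) hac
  have hR0 : algebraMap (Polynomial ℂ) (RatFunc ℂ) R ≠ 0 := RatFunc.algebraMap_ne_zero hR
  have hca : algebraMap (Polynomial ℂ) (RatFunc ℂ) R * algebraMap _ _ (conjZ a') =
      δ * m * algebraMap _ _ N := by
    have := congrArg conjRat ha
    simp only [map_mul, conjRat_algebraMap, hNc, hRc, f01] at this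
    linear_combination -this + δ * algebraMap _ _ N * hml
  have hcb : algebraMap (Polynomial ℂ) (RatFunc ℂ) R * algebraMap _ _ (conjZ b') =
      γ * m * algebraMap _ _ N := by
    have := congrArg conjZ hb'
    simp only [map_mul, conjZ_conjZ, hRc] at this
    rw [hc, this, map_mul]
  have hcb' : algebraMap (Polynomial ℂ) (RatFunc ℂ) R * algebraMap _ _ b' * η =
      β * m * algebraMap _ _ N := by
    have := congrArg conjRat hcb
    simp only [map_mul, conjRat_algebraMap, hNc, hRc, conjZ_conjZ] at this
    linear_combination η * this + conjRat m * algebraMap _ _ N * f11 +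
      β * algebraMap _ _ N * hml
  refine ⟨a', b', hab, isStd_of_smul (k := m * algebraMap _ _ N / algebraMap _ _ R)
    (div_ne_zero (mul_ne_zero hm hN0) hR0) ?_ ?_ ?_ ?_⟩
  · rw [hα, mul_div_assoc', div_eq_iff hR0]
    rw [map_mul] at ha
    linear_combination ha
  · rw [hβ, mul_div_assoc', div_eq_iff hR0, map_mul, hη]
    linear_combination -hcb'
  · rw [hγ, mul_div_assoc', div_eq_iff hR0]
    linear_combination -hcb
  · rw [hδ, mul_div_assoc', div_eq_iff hR0]
    linear_combination -hca

end

section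

open Matrix.ProjGenLinGroup (mk)
open MvPolynomial (eval)

/-! ## Values of rational functions at real points -/

/-- A real point as a point of the complex affine space. -/
def cpt (p : E3) : Fin 3 → ℂ := fun i => (p i : ℂ)

theorem mem_realSphere_iff (p : E3) : p ∈ realSphere ↔ p 0 ^ 2 + p 1 ^ 2 + p 2 ^ 2 = 1 := by
  rw [mem_sphere_zero_iff_norm, EuclideanSpace.norm_eq, Real.sqrt_eq_one, Fin.sum_univ_three]
  simp

theorem eval_sphereEq {p : E3} (hp : p ∈ realSphere) : eval (cpt p) sphereEq = 0 := by
  rw [mem_realSphere_iff] at hp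
  have : ((p 0 ^ 2 + p 1 ^ 2 + p 2 ^ 2 : ℝ) : ℂ) = 1 := by rw [hp]; simp
  push_cast at this
  simp only [sphereEq, map_sub, map_add, map_pow, MvPolynomial.eval_X, map_one, cpt]
  linear_combination this

section Values

variable {p : E3} {g k : FunField} {c d : ℂ}

theorem HasValueAt.unique (hp : p ∈ realSphere) (h : HasValueAt g p c) (h' : HasValueAt g p d) :
    c = d := by
  obtain ⟨u, v, hv, hg, hc⟩ := h
  obtain ⟨u', v', hv', hg', hd⟩ := h'
  have h1 : ofPoly (u * v') = ofPoly (u' * v) := by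
    rw [map_mul, map_mul, ← hg, ← hg']
    ring
  have h2 := eval_eq_of_ofPoly_eq h1 (eval_sphereEq hp)
  rw [map_mul, map_mul] at h2
  change eval (cpt p) v ≠ 0 at hv
  change eval (cpt p) v' ≠ 0 at hv'
  change c * eval (cpt p) v = eval (cpt p) u at hc
  change d * eval (cpt p) v' = eval (cpt p) u' at hd
  rw [← hc, ← hd] at h2
  exact mul_right_cancel₀ (mul_ne_zero hv hv') (by linear_combination h2)

theorem hasValueAt_ofPoly (p : E3) (u : MvPolynomial (Fin 3) ℂ) :
    HasValueAt (ofPoly u) p (eval (cpt p) u) :=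
  ⟨u, 1, by simp, by simp, by simp; rfl⟩

theorem HasValueAt.add (h : HasValueAt g p c) (h' : HasValueAt k p d) :
    HasValueAt (g + k) p (c + d) := by
  obtain ⟨u, v, hv, hg, hc⟩ := h
  obtain ⟨u', v', hv', hg', hd⟩ := h'
  refine ⟨u * v' + u' * v, v * v', ?_, ?_, ?_⟩
  · rw [map_mul]; exact mul_ne_zero hv hv'
  · simp only [map_mul, map_add, ← hg, ← hg']; ring
  · simp only [map_mul, map_add, ← hc, ← hd]; ring

theorem HasValueAt.mul (h : HasValueAt g p c) (h' : HasValueAt k p d) :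
    HasValueAt (g * k) p (c * d) := by
  obtain ⟨u, v, hv, hg, hc⟩ := h
  obtain ⟨u', v', hv', hg', hd⟩ := h'
  refine ⟨u * u', v * v', ?_, ?_, ?_⟩
  · rw [map_mul]; exact mul_ne_zero hv hv'
  · simp only [map_mul, ← hg, ← hg']; ring
  · simp only [map_mul, ← hc, ← hd]; ring

theorem HasValueAt.ne_zero (hp : p ∈ realSphere) (h : HasValueAt g p c) (hc : c ≠ 0) : g ≠ 0 := by
  rintro rfl
  exact hc (h.unique hp ⟨0, 1, by simp, by simp, by simp⟩)

theorem HasValueAt.inv (hp : p ∈ realSphere) (h : HasValueAt g p c) (hc : c ≠ 0) :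
    HasValueAt g⁻¹ p c⁻¹ := by
  have hg0 := h.ne_zero hp hc
  obtain ⟨u, v, hv, hg, hcv⟩ := h
  refine ⟨v, u, ?_, ?_, ?_⟩
  · rw [← hcv]; exact mul_ne_zero hc hv
  · rw [← hg, inv_mul_cancel_left₀ hg0]
  · rw [← hcv, inv_mul_cancel_left₀ hc]

theorem HasValueAt.div (hp : p ∈ realSphere) (h : HasValueAt g p c) (h' : HasValueAt k p d)
    (hd : d ≠ 0) : HasValueAt (g / k) p (c / d) := by
  rw [div_eq_mul_inv, div_eq_mul_inv]
  exact h.mul (h'.inv hp hd)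

theorem eval_conjPoly (p : E3) (u : MvPolynomial (Fin 3) ℂ) :
    eval (cpt p) (conjPoly u) = starRingEnd ℂ (eval (cpt p) u) := by
  induction u using MvPolynomial.induction_on with
  | C a => simp
  | add p q hp hq => rw [map_add, map_add, hp, hq, map_add, map_add]
  | mul_X q i hq => rw [map_mul, map_mul, hq, map_mul, map_mul, conjPoly_X]; simp [cpt]

theorem HasValueAt.sigma (h : HasValueAt g p c) :
    HasValueAt (sigma g) p (starRingEnd ℂ c) := by
  obtain ⟨u, v, hv, hg, hc⟩ := h
  change eval (cpt p) v ≠ 0 at hv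
  change c * eval (cpt p) v = eval (cpt p) u at hc
  refine ⟨conjPoly u, conjPoly v, ?_, ?_, ?_⟩
  · change eval (cpt p) _ ≠ 0
    rw [eval_conjPoly]
    simpa using hv
  · rw [← sigma_ofPoly, ← sigma_ofPoly, ← map_mul, hg]
  · change _ * eval (cpt p) _ = eval (cpt p) _
    rw [eval_conjPoly, eval_conjPoly, ← map_mul, hc]

/-- Values of rational functions are compatible with composition. -/
theorem HasValueAt.comp (hp : p ∈ realSphere) {q : E3} (f : FunField ≃ₐ[ℂ] FunField)
    (hf : ∀ i, HasValueAt (f (ofPoly (MvPolynomial.X i))) p (q i)) (h : HasValueAt g q c) :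
    HasValueAt (f g) p c := by
  have hpoly : ∀ u, HasValueAt (f (ofPoly u)) p (eval (cpt q) u) := by
    intro u
    induction u using MvPolynomial.induction_on with
    | C a =>
      have : f (ofPoly (MvPolynomial.C a)) = ofPoly (MvPolynomial.C a) := by
        rw [← MvPolynomial.algebraMap_eq, AlgHom.commutes, AlgEquiv.commutes]
      rw [this]
      simpa using hasValueAt_ofPoly p (MvPolynomial.C a)
    | add u v hu hv => simpa only [map_add] using hu.add hv
    | mul_X u i hu => simpa only [map_mul, MvPolynomial.eval_X] using! hu.mul (hf i)
  obtain ⟨u, v, hv, hg, hc⟩ := h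
  have hfv := (hpoly v).ne_zero hp hv
  have h1 : f g = f (ofPoly u) / f (ofPoly v) := by
    rw [eq_div_iff hfv, ← map_mul, hg]
  have h2 : c = eval (cpt q) u / eval (cpt q) v := by
    exact (eq_div_iff hv).2 hc
  rw [h1, h2]
  exact (hpoly u).div hp (hpoly v) hv

end Values

/-! ## Rational maps defined at real points -/

/-- The real birational map `f` is defined at `p` with image the real point `q`. -/
def MapsPt (f : BirC) (p q : E3) : Prop :=
  ∀ i, HasValueAt (f.unop (ofPoly (MvPolynomial.X i))) p (q i)

theorem MapsPt.unique {f : BirC} {p q q' : E3} (hp : p ∈ realSphere) (h : MapsPt f p q)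
    (h' : MapsPt f p q') : q = q' := by
  ext i
  exact Complex.ofReal_injective ((h i).unique hp (h' i))

/-- With first coordinate `1`, the common multiplier itself has value `1` at `p` and can be divided
out. -/
theorem mapsPt_iff_hasImageAt {f : BirC} {p q : E3} (hp : p ∈ realSphere) :
    MapsPt f p q ↔ HasImageAt f p ![1, (q 0 : ℂ), (q 1 : ℂ), (q 2 : ℂ)] := by
  constructor
  · intro h
    refine ⟨fun h0 => one_ne_zero (congrFun h0 0), 1, ?_⟩
    intro i
    rw [one_mul]
    fin_cases i
    · simpa [homCoord] using hasValueAt_ofPoly p 1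
    · exact h 0
    · exact h 1
    · exact h 2
  · rintro ⟨-, l, hl⟩
    have h0 := hl 0
    simp only [homCoord, Matrix.cons_val_zero, map_one, mul_one] at h0
    have hl0 : l ≠ 0 := h0.ne_zero hp one_ne_zero
    intro i
    have h1 : HasValueAt (l * f.unop (ofPoly (MvPolynomial.X i))) p (q i) := by
      fin_cases i
      · exact hl 1
      · exact hl 2
      · exact hl 3
    have h2 := h1.div hp h0 one_ne_zero
    rwa [mul_div_cancel_left₀ _ hl0, div_one] at h2

/-- The quadric has no real point at infinity. The symmetry hypothesis says that `v` is proportional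
to its conjugate, so multiplying by the conjugate of a nonzero coordinate gives a real vector; if `v
0 = 0`, its squares sum to zero. -/
theorem first_ne_zero_of_real_point {v : Fin 4 → ℂ} (hv : v ≠ 0)
    (hsum : v 1 ^ 2 + v 2 ^ 2 + v 3 ^ 2 = v 0 ^ 2)
    (hreal : ∀ i j, v i * starRingEnd ℂ (v j) = v j * starRingEnd ℂ (v i)) : v 0 ≠ 0 := by
  intro h0
  obtain ⟨j, hj⟩ := Function.ne_iff.1 hv
  have hre : ∀ i, ((v i * starRingEnd ℂ (v j)).re : ℂ) = v i * starRingEnd ℂ (v j) := by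
    intro i
    rw [← Complex.conj_eq_iff_re, map_mul, Complex.conj_conj, hreal i j]
    ring
  set w : Fin 4 → ℝ := fun i => (v i * starRingEnd ℂ (v j)).re with hw
  have hs : w 1 ^ 2 + w 2 ^ 2 + w 3 ^ 2 = 0 := by
    apply Complex.ofReal_injective
    push_cast
    rw [hre, hre, hre, mul_pow, mul_pow, mul_pow]
    rw [h0] at hsum
    linear_combination (starRingEnd ℂ (v j)) ^ 2 * hsum
  have h1 : w 1 = 0 := by nlinarith [sq_nonneg (w 1), sq_nonneg (w 2), sq_nonneg (w 3)]
  have h2 : w 2 = 0 := by nlinarith [sq_nonneg (w 1), sq_nonneg (w 2), sq_nonneg (w 3)]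
  have h3 : w 3 = 0 := by nlinarith [sq_nonneg (w 1), sq_nonneg (w 2), sq_nonneg (w 3)]
  have hwj : w j ≠ 0 := by
    intro h
    have := hre j
    rw [show (v j * starRingEnd ℂ (v j)).re = 0 from h, Complex.mul_conj] at this
    exact hj (by simpa using this.symm)
  fin_cases j
  · exact hj h0
  · exact hwj h1
  · exact hwj h2
  · exact hwj h3

theorem sum_sq_coord : ofPoly (MvPolynomial.X 0) ^ 2 + ofPoly (MvPolynomial.X 1) ^ 2 +
    ofPoly (MvPolynomial.X 2) ^ 2 = 1 := by
  rw [← sub_eq_zero]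
  have := (ofPoly_eq_zero_iff sphereEq).2 dvd_rfl
  simpa [sphereEq] using this

/-- Commutation with `σ` makes the image a real point of the quadric, and all such points lie in the
chart `w = 1`. -/
theorem exists_mapsPt {f : BirC} (hf : f ∈ birS) {p : E3} (hp : p ∈ realSphere) {v : Fin 4 → ℂ}
    (h : HasImageAt f p v) : ∃ q ∈ realSphere, MapsPt f p q := by
  obtain ⟨hv, l, hl⟩ := h
  have hs : ∀ i, sigma (homCoord i) = homCoord i := by
    intro i
    fin_cases i
    · exact map_one sigma
    · exact sigma_X 0
    · exact sigma_X 1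
    · exact sigma_X 2
  have hsl : ∀ i, sigma (l * f.unop (homCoord i)) = sigma l * f.unop (homCoord i) := by
    intro i
    rw [map_mul, ← hf, hs]
  -- The coordinates pulled back by `f` are `σ`-invariant, so the functions having these two values
  -- are the same.
  have hreal : ∀ i j, v i * starRingEnd ℂ (v j) = v j * starRingEnd ℂ (v i) := by
    intro i j
    refine HasValueAt.unique hp ((hl i).mul (hl j).sigma) ?_
    convert (hl j).mul (hl i).sigma using 1
    rw [hsl, hsl]
    ring
  have hsum : v 1 ^ 2 + v 2 ^ 2 + v 3 ^ 2 = v 0 ^ 2 := by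
    simp only [pow_two]
    refine HasValueAt.unique hp (((hl 1).mul (hl 1)).add ((hl 2).mul (hl 2)) |>.add
      ((hl 3).mul (hl 3))) ?_
    convert (hl 0).mul (hl 0) using 1
    have := congrArg f.unop sum_sq_coord
    simp only [map_add, map_pow, map_one] at this
    change l * f.unop (ofPoly (MvPolynomial.X 0)) * (l * f.unop (ofPoly (MvPolynomial.X 0))) +
      l * f.unop (ofPoly (MvPolynomial.X 1)) * (l * f.unop (ofPoly (MvPolynomial.X 1))) +
      l * f.unop (ofPoly (MvPolynomial.X 2)) * (l * f.unop (ofPoly (MvPolynomial.X 2))) =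
      l * f.unop 1 * (l * f.unop 1)
    rw [map_one]
    linear_combination l ^ 2 * this
  have h0 := first_ne_zero_of_real_point hv hsum hreal
  have hl0 := hl 0
  simp only [homCoord, Matrix.cons_val_zero, map_one, mul_one] at hl0
  have hlne : l ≠ 0 := hl0.ne_zero hp h0
  have hdiv : ∀ i, HasValueAt (f.unop (homCoord i)) p (v i / v 0) := by
    intro i
    have := (hl i).div hp hl0 h0
    rwa [mul_div_cancel_left₀ _ hlne] at this
  have hre : ∀ i, (((v i / v 0).re : ℝ) : ℂ) = v i / v 0 := by
    intro i
    rw [← Complex.conj_eq_iff_re, map_div₀, div_eq_div_iff (by simpa using h0) h0]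
    linear_combination -hreal i 0
  refine ⟨!₂[(v 1 / v 0).re, (v 2 / v 0).re, (v 3 / v 0).re], ?_, ?_⟩
  · rw [mem_realSphere_iff]
    apply Complex.ofReal_injective
    simp only [Matrix.cons_val]
    push_cast
    rw [hre, hre, hre]
    field_simp
    exact hsum
  · intro i
    fin_cases i
    · exact (hre 1).symm ▸ hdiv 1
    · exact (hre 2).symm ▸ hdiv 2
    · exact (hre 3).symm ▸ hdiv 3

theorem definedOnReal_iff {f : BirC} (hf : f ∈ birS) :
    DefinedOnReal f ↔ ∀ p ∈ realSphere, ∃ q ∈ realSphere, MapsPt f p q := by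
  constructor
  · intro h p hp
    obtain ⟨v, hv⟩ := h p hp
    exact exists_mapsPt hf hp hv
  · intro h p hp
    obtain ⟨q, -, hq⟩ := h p hp
    exact ⟨_, (mapsPt_iff_hasImageAt hp).1 hq⟩

theorem MapsPt.comp {f g : BirC} {p q r : E3} (hp : p ∈ realSphere) (hg : MapsPt g p q)
    (hf : MapsPt f q r) : MapsPt (f * g) p r := fun i =>
  (hf i).comp hp g.unop hg

theorem mapsPt_one (p : E3) : MapsPt 1 p p := fun i => by
  simpa [cpt] using hasValueAt_ofPoly p (MvPolynomial.X i)

end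

section

open Matrix.ProjGenLinGroup (mk)
open MvPolynomial (eval)

/-! ## The action of an element of `𝒢` on the real sphere -/

/-- The value of `t = x - i y` at a real point. -/
def tval (p : E3) : ℂ := (p 0 : ℂ) - Complex.I * (p 1 : ℂ)

/-- The value of `a + b u` at a real point. -/
def mval (a b : Polynomial ℂ) (p : E3) : ℂ :=
  a.eval (p 2 : ℂ) + b.eval (p 2 : ℂ) * starRingEnd ℂ (tval p)

/-- The value of `(a t + b h) / (b̄ t + ā)` at a real point. -/
def Tval (a b : Polynomial ℂ) (p : E3) : ℂ :=
  tval p * mval a b p / starRingEnd ℂ (mval a b p)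

/-- The map of the real sphere induced by the class of `[[a, b h], [b̄, ā]]`. -/
def realMap (a b : Polynomial ℂ) (p : E3) : E3 :=
  !₂[(Tval a b p).re, -(Tval a b p).im, p 2]

theorem normSq_tval (p : E3) : Complex.normSq (tval p) = p 0 ^ 2 + p 1 ^ 2 := by
  simp [tval, Complex.normSq_apply]
  ring

theorem normSq_tval_of_mem {p : E3} (hp : p ∈ realSphere) :
    Complex.normSq (tval p) = 1 - p 2 ^ 2 := by
  rw [mem_realSphere_iff] at hp
  rw [normSq_tval]
  linarith

theorem tval_mul_conj {p : E3} (hp : p ∈ realSphere) :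
    tval p * starRingEnd ℂ (tval p) = hPoly.eval (p 2 : ℂ) := by
  rw [Complex.mul_conj, normSq_tval_of_mem hp, eval_hPoly]

theorem hasValueAt_tFun (p : E3) : HasValueAt tFun p (tval p) := by
  have := hasValueAt_ofPoly p
    (MvPolynomial.X 0 - MvPolynomial.C Complex.I * MvPolynomial.X 1)
  have h : eval (cpt p) (MvPolynomial.X 0 - MvPolynomial.C Complex.I * MvPolynomial.X 1) =
      tval p := by simp [tval, cpt]
  rw [h] at this
  exact this

theorem hasValueAt_zEmb (p : E3) (q : Polynomial ℂ) :
    HasValueAt (zEmb (algebraMap _ _ q)) p (q.eval (p 2 : ℂ)) := by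
  rw [zEmb_algebraMap]
  have := hasValueAt_ofPoly p (Polynomial.aeval (MvPolynomial.X 2) q)
  rwa [eval_aeval_X_two] at this

/-- For a real map the value of the image of `u` is the conjugate of that of `t`, and `x, y` are
linear in `t, u`. Hence it suffices to evaluate the image of `t`. -/
theorem mapsPt_of_tFun {f : BirC} (hf : f ∈ birOver) {p : E3} {T : ℂ}
    (hT : HasValueAt (f.unop tFun) p T) : MapsPt f p !₂[T.re, -T.im, p 2] := by
  have hU : HasValueAt (f.unop uFun) p (starRingEnd ℂ T) := by
    rw [← sigma_tFun, hf.1]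
    exact hT.sigma
  have hC : ∀ c, f.unop (ofPoly (MvPolynomial.C c)) = ofPoly (MvPolynomial.C c) := by
    intro c
    rw [← MvPolynomial.algebraMap_eq, AlgHom.commutes, AlgEquiv.commutes]
  have hCv : ∀ c, HasValueAt (ofPoly (MvPolynomial.C c)) p c := by
    intro c
    simpa using hasValueAt_ofPoly p (MvPolynomial.C c)
  have hsub : HasValueAt (f.unop tFun - f.unop uFun) p (T + (-1) * starRingEnd ℂ T) := by
    have h1 : HasValueAt (-1) p (-1) := by simpa using hCv (-1)
    have := hT.add (h1.mul hU)
    rwa [neg_one_mul, ← sub_eq_add_neg] at this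
  intro i
  fin_cases i
  · have h := (hCv (1 / 2)).mul (hT.add hU)
    rw [← hC, ← map_add, ← map_mul, ← ofPoly_X_zero] at h
    have hc : 1 / 2 * (T + starRingEnd ℂ T) = (T.re : ℂ) := by
      apply Complex.ext <;> simp
      ring
    rw [hc] at h
    exact h
  · have h := (hCv (Complex.I / 2)).mul hsub
    rw [← hC, ← map_sub, ← map_mul, ← ofPoly_X_one] at h
    have hc : Complex.I / 2 * (T + -1 * starRingEnd ℂ T) = ((-T.im : ℝ) : ℂ) := by
      apply Complex.ext <;> simp
      ring
    rw [hc] at h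
    exact h
  · change HasValueAt (f.unop (ofPoly (MvPolynomial.X 2))) p (p 2)
    rw [hf.2]
    have := hasValueAt_ofPoly p (MvPolynomial.X 2)
    rwa [MvPolynomial.eval_X] at this

theorem IsStd.unop_tFun {A : PGL(2, RatFunc ℂ)} {a b : Polynomial ℂ} (hA : IsStd A a b) {f : BirC}
    (hf : PsiConj f A) : f.unop tFun =
      (zEmb (algebraMap _ _ a) * tFun + zEmb (algebraMap _ _ (b * hPoly))) /
        (zEmb (algebraMap _ _ (conjZ b)) * tFun + zEmb (algebraMap _ _ (conjZ a))) := by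
  obtain ⟨M, rfl, h00, h01, h10, h11⟩ := hA.exists_entries
  rw [hf.unop_tFun, mob, h00, h01, h10, h11]

/-- On the sphere `h = t t̄`, so the numerator `at + bh` is `t m` and the denominator is `m̄`. -/
theorem IsStd.mapsPt {A : PGL(2, RatFunc ℂ)} {a b : Polynomial ℂ} (hA : IsStd A a b) {f : BirC}
    (hf : PsiConj f A) {p : E3} (hp : p ∈ realSphere) (hm : mval a b p ≠ 0) :
    MapsPt f p (realMap a b p) := by
  apply mapsPt_of_tFun (hf.mem_birOver_iff.2 hA.mem_scriptG)
  rw [hA.unop_tFun hf]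
  have hn := ((hasValueAt_zEmb p a).mul (hasValueAt_tFun p)).add (hasValueAt_zEmb p (b * hPoly))
  have hd := ((hasValueAt_zEmb p (conjZ b)).mul (hasValueAt_tFun p)).add
    (hasValueAt_zEmb p (conjZ a))
  have hn' : a.eval (p 2 : ℂ) * tval p + (b * hPoly).eval (p 2 : ℂ) = tval p * mval a b p := by
    rw [Polynomial.eval_mul, ← tval_mul_conj hp, mval]
    ring
  have hd' : (conjZ b).eval (p 2 : ℂ) * tval p + (conjZ a).eval (p 2 : ℂ) =
      starRingEnd ℂ (mval a b p) := by
    rw [eval_conjZ, eval_conjZ, mval, map_add, map_mul, Complex.conj_conj]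
    ring
  rw [hn'] at hn
  rw [hd'] at hd
  exact hn.div hp hd (by simpa using hm)

/-- The factor `m / m̄` has modulus one, so horizontal circles are preserved. -/
theorem normSq_Tval {a b : Polynomial ℂ} {p : E3} (hm : mval a b p ≠ 0) :
    Complex.normSq (Tval a b p) = Complex.normSq (tval p) := by
  rw [Tval, Complex.normSq_div, Complex.normSq_mul, Complex.normSq_conj, mul_div_assoc,
    div_self (by simpa using hm), mul_one]

theorem realMap_mem {a b : Polynomial ℂ} {p : E3} (hp : p ∈ realSphere) (hm : mval a b p ≠ 0) :
    realMap a b p ∈ realSphere := by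
  have h := normSq_Tval hm
  rw [normSq_tval_of_mem hp, Complex.normSq_apply] at h
  rw [mem_realSphere_iff]
  simp only [realMap, Matrix.cons_val]
  linarith

theorem mval_ne_zero {a b : Polynomial ℂ} {p : E3} (hp : p ∈ realSphere)
    (h : detFun a b (p 2) ≠ 0) : mval a b p ≠ 0 := by
  intro hm
  apply h
  have h1 : a.eval (p 2 : ℂ) = - (b.eval (p 2 : ℂ) * starRingEnd ℂ (tval p)) :=
    eq_neg_of_add_eq_zero_left hm
  rw [detFun, h1, Complex.normSq_neg, Complex.normSq_mul, Complex.normSq_conj,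
    normSq_tval_of_mem hp, sub_self]

/-- If the determinant vanishes inside the interval, then the corresponding circle is contracted
to a point. -/
theorem IsStd.detFun_ne_zero {A : PGL(2, RatFunc ℂ)} {a b : Polynomial ℂ} (hA : IsStd A a b)
    {f : BirC} (hf : PsiConj f A) (hdef : DefinedOnReal f⁻¹) {r : ℝ} (hr : r ^ 2 < 1)
    (hab : a.eval (r : ℂ) ≠ 0 ∨ b.eval (r : ℂ) ≠ 0) : detFun a b r ≠ 0 := by
  intro h0
  rw [detFun] at h0
  set α := a.eval (r : ℂ) with hα
  set β := b.eval (r : ℂ) with hβ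
  have hs : 0 < 1 - r ^ 2 := by linarith
  have hβ0 : β ≠ 0 := by
    intro h
    have : α = 0 := by simpa [h] using h0
    tauto
  have hα0 : α ≠ 0 := by
    intro h
    have : Complex.normSq β * (1 - r ^ 2) = 0 := by
      rw [h, map_zero] at h0
      linarith
    simp [hs.ne', hβ0] at this
  have hαc : starRingEnd ℂ α ≠ 0 := by simpa using hα0
  have hβc : starRingEnd ℂ β ≠ 0 := by simpa using hβ0
  -- The unique zero of `m = α + β t̄` at height `r`; the vanishing determinant is what puts it on
  -- the circle.
  set t₀ : ℂ := - starRingEnd ℂ α / starRingEnd ℂ β with ht₀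
  have ht₀c : starRingEnd ℂ t₀ = - α / β := by simp [ht₀]
  have hn₀ : Complex.normSq t₀ = 1 - r ^ 2 := by
    rw [ht₀, Complex.normSq_div, Complex.normSq_neg, Complex.normSq_conj, Complex.normSq_conj,
      div_eq_iff (by simpa using hβ0)]
    linarith
  -- Every other point `w t₀` of the circle goes to the single value `α / β̄` of `t`.
  have key : ∀ w : ℂ, Complex.normSq w = 1 → w ≠ 1 →
      ∃ p ∈ realSphere, tval p = w * t₀ ∧
        MapsPt f p !₂[(α / starRingEnd ℂ β).re, -(α / starRingEnd ℂ β).im, r] := by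
    intro w hw hw1
    set p : E3 := !₂[(w * t₀).re, -(w * t₀).im, r] with hp
    have htp : tval p = w * t₀ := by
      apply Complex.ext <;> simp [tval, hp]
    have hps : p ∈ realSphere := by
      have : Complex.normSq (w * t₀) = 1 - r ^ 2 := by rw [Complex.normSq_mul, hw, hn₀, one_mul]
      rw [Complex.normSq_apply] at this
      rw [mem_realSphere_iff]
      simp only [hp, Matrix.cons_val]
      linarith
    have hp2 : p 2 = r := rfl
    have hwc : w * starRingEnd ℂ w = 1 := by rw [Complex.mul_conj, hw]; simp
    have hm : mval a b p = α * (1 - starRingEnd ℂ w) := by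
      rw [mval, htp, hp2, ← hα, ← hβ, map_mul, ht₀c]
      field_simp
      ring
    have hw1' : 1 - w ≠ 0 := sub_ne_zero.2 (Ne.symm hw1)
    have hw1c : 1 - starRingEnd ℂ w ≠ 0 := by
      intro h
      apply hw1'
      have := congrArg (starRingEnd ℂ) h
      simpa using this
    have hm0 : mval a b p ≠ 0 := by rw [hm]; exact mul_ne_zero hα0 hw1c
    have hT : Tval a b p = α / starRingEnd ℂ β := by
      rw [Tval, htp, hm, map_mul, map_sub, map_one, Complex.conj_conj, ht₀,
        div_eq_div_iff (mul_ne_zero hαc hw1') hβc]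
      field_simp
      linear_combination hwc
    refine ⟨p, hps, htp, ?_⟩
    have := hA.mapsPt hf hps hm0
    rwa [realMap, hT] at this
  have hbir : f ∈ birS := hf.mem_birS_iff.2 hA.mem_scriptG
  have hfin := (definedOnReal_iff (birS.inv_mem hbir)).1 hdef
  -- The choices `w = -1` and `w = i` give two distinct points with one image, where the inverse is
  -- defined, and this forces them to coincide.
  obtain ⟨p₁, hp₁, ht₁, hm₁⟩ := key (-1) (by simp) (by norm_num)
  obtain ⟨p₂, hp₂, ht₂, hm₂⟩ := key Complex.I (by simp) (by
    intro h
    simpa using congrArg Complex.re h)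
  have hq : !₂[(α / starRingEnd ℂ β).re, -(α / starRingEnd ℂ β).im, r] ∈ realSphere := by
    have h1 : Complex.normSq (α / starRingEnd ℂ β) = 1 - r ^ 2 := by
      rw [← hn₀, ht₀]
      simp
    rw [Complex.normSq_apply] at h1
    rw [mem_realSphere_iff]
    simp only [Matrix.cons_val]
    linarith
  obtain ⟨q, -, hqm⟩ := hfin _ hq
  have e₁ := hm₁.comp hp₁ hqm
  have e₂ := hm₂.comp hp₂ hqm
  rw [inv_mul_cancel] at e₁ e₂
  have hpp : p₁ = p₂ := ((mapsPt_one p₁).unique hp₁ e₁).trans ((mapsPt_one p₂).unique hp₂ e₂).symm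
  rw [hpp, ht₂] at ht₁
  have ht0 : t₀ ≠ 0 := by
    rw [ht₀]
    exact div_ne_zero (neg_ne_zero.2 hαc) hβc
  have := mul_right_cancel₀ ht0 ht₁
  simpa using congrArg Complex.re this

/-! ## Elements of `Aut(S(ℝ)/π)` -/

theorem IsStd.mem_autRealOver {A : PGL(2, RatFunc ℂ)} {a b : Polynomial ℂ} (hA : IsStd A a b)
    {f : BirC} (hf : PsiConj f A) (hpos : ∀ r, detFun a b r ≠ 0) : f ∈ autRealOver := by
  have hbir := hf.mem_birS_iff.2 hA.mem_scriptG
  refine ⟨⟨hbir, ?_, ?_⟩, hf.mem_birOver_iff.2 hA.mem_scriptG⟩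
  · rw [definedOnReal_iff hbir]
    intro p hp
    have hm := mval_ne_zero hp (hpos (p 2))
    exact ⟨_, realMap_mem hp hm, hA.mapsPt hf hp hm⟩
  · rw [definedOnReal_iff (birS.inv_mem hbir)]
    intro p hp
    have hm : mval (conjZ a) (-b) p ≠ 0 :=
      mval_ne_zero hp (by rw [detFun_inv]; exact hpos (p 2))
    exact ⟨_, realMap_mem hp hm, hA.inv.mapsPt hf.inv hp hm⟩

theorem autRealOver_mul {f g : BirC} (hf : f ∈ autRealOver) (hg : g ∈ autRealOver) :
    f * g ∈ autRealOver := by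
  obtain ⟨⟨hf1, hf2, hf3⟩, hf4⟩ := hf
  obtain ⟨⟨hg1, hg2, hg3⟩, hg4⟩ := hg
  have key : ∀ {f g : BirC}, f ∈ birS → g ∈ birS → DefinedOnReal f → DefinedOnReal g →
      DefinedOnReal (f * g) := by
    intro f g hf hg hfd hgd
    rw [definedOnReal_iff hf] at hfd
    rw [definedOnReal_iff hg] at hgd
    rw [definedOnReal_iff (birS.mul_mem hf hg)]
    intro p hp
    obtain ⟨q, hq, hpq⟩ := hgd p hp
    obtain ⟨r, hr, hqr⟩ := hfd q hq
    exact ⟨r, hr, hpq.comp hp hqr⟩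
  refine ⟨⟨birS.mul_mem hf1 hg1, key hf1 hg1 hf2 hg2, ?_⟩, birOver.mul_mem hf4 hg4⟩
  rw [mul_inv_rev]
  exact key (birS.inv_mem hg1) (birS.inv_mem hf1) hg3 hf3

theorem tau_mem_scriptG : tau ∈ scriptG := by
  rw [tau, mem_scriptG_iff]
  congr 1
  ext i j
  rw [gl_mul_entry, gl_mul_entry]
  fin_cases i <;> fin_cases j <;>
  simp only [Fin.zero_eta, Fin.mk_one, tauGL_00, tauGL_01, tauGL_10, tauGL_11, conjGL_entry,
    conjRat_algebraMap, conjZ_hPoly, map_zero, map_one]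

/-- On real points `τ` is the reflection `t ↦ t̄`, that is `y ↦ -y`, and it is its own inverse. -/
theorem mem_autRealOver_of_tau {f : BirC} (hf : PsiConj f tau) : f ∈ autRealOver := by
  have hbo := hf.mem_birOver_iff.2 tau_mem_scriptG
  have hinv : f⁻¹ = f := by
    have h1 := hf.inv
    have h2 : tau⁻¹ = tau := (eq_inv_of_mul_eq_one_right tau_mul_tau).symm
    rw [h2] at h1
    exact h1.injective hf
  have hd : DefinedOnReal f := by
    rw [definedOnReal_iff hbo.1]
    intro p hp
    have ht : HasValueAt (f.unop tFun) p (starRingEnd ℂ (tval p)) := by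
      rw [PsiConj.unop_tFun (M := tauGL) hf, mob_tauGL_tFun, ← sigma_tFun]
      exact (hasValueAt_tFun p).sigma
    refine ⟨_, ?_, mapsPt_of_tFun hbo ht⟩
    rw [mem_realSphere_iff] at hp ⊢
    simpa [tval] using hp
  exact ⟨⟨hbo.1, hd, by rwa [hinv]⟩, hbo⟩

end

section

open Polynomial (C X)

/-! ## The sign of the determinant -/

theorem continuous_detFun (a b : Polynomial ℂ) : Continuous (detFun a b) := by
  have h : ∀ q : Polynomial ℂ, Continuous fun r : ℝ => Complex.normSq (q.eval (r : ℂ)) := fun q =>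
    Complex.continuous_normSq.comp (q.continuous.comp Complex.continuous_ofReal)
  exact (h a).sub ((h b).mul (by fun_prop))

theorem detFun_of_sq_eq_one {a b : Polynomial ℂ} {r : ℝ} (hr : r ^ 2 = 1) :
    detFun a b r = Complex.normSq (a.eval (r : ℂ)) := by
  rw [detFun, hr, sub_self, mul_zero, sub_zero]

/-- Here `h < 0`, so the determinant is a sum of two nonnegative terms that do not both vanish. -/
theorem detFun_pos_of_one_lt_sq {a b : Polynomial ℂ} {r : ℝ} (hr : 1 < r ^ 2)
    (hab : a.eval (r : ℂ) ≠ 0 ∨ b.eval (r : ℂ) ≠ 0) : 0 < detFun a b r := by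
  have ha := Complex.normSq_nonneg (a.eval (r : ℂ))
  have hb := Complex.normSq_nonneg (b.eval (r : ℂ))
  rw [detFun]
  rcases hab with h | h
  · have := Complex.normSq_pos.2 h
    nlinarith
  · have := Complex.normSq_pos.2 h
    nlinarith

/-- Towards a zero `e = ±1` of `a`, the term `|a|²` decays quadratically in the distance, while
`|b|² h` decays only linearly. -/
theorem exists_detFun_neg {a b : Polynomial ℂ} {e : ℝ} (he : e ^ 2 = 1)
    (ha : a.eval (e : ℂ) = 0) (hb : b.eval (e : ℂ) ≠ 0) : ∃ r : ℝ, r ^ 2 < 1 ∧ detFun a b r < 0 := by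
  obtain ⟨a₁, rfl⟩ := Polynomial.dvd_iff_isRoot.2 ha
  -- The determinant at `e(1 - d)` divided by `d`, using `1 - (1 - d)² = d(2 - d)`.
  let φ : ℝ → ℝ := fun d => d * Complex.normSq (a₁.eval ((e * (1 - d) : ℝ) : ℂ)) -
    Complex.normSq (b.eval ((e * (1 - d) : ℝ) : ℂ)) * (2 - d)
  have hφ : Continuous φ := by
    have h : ∀ q : Polynomial ℂ,
        Continuous fun d : ℝ => Complex.normSq (q.eval ((e * (1 - d) : ℝ) : ℂ)) := fun q =>
      Complex.continuous_normSq.comp (q.continuous.comp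
        (Complex.continuous_ofReal.comp (by fun_prop)))
    exact (continuous_id.mul (h a₁)).sub ((h b).mul (by fun_prop))
  have hφ0 : φ 0 < 0 := by
    have := Complex.normSq_pos.2 hb
    simp only [φ, sub_zero, mul_one, zero_mul, zero_sub]
    linarith
  have hev : ∀ᶠ d in nhdsWithin (0 : ℝ) (Set.Ioi 0), φ d < 0 :=
    (hφ.tendsto 0).eventually (gt_mem_nhds hφ0) |>.filter_mono nhdsWithin_le_nhds
  have hev2 : ∀ᶠ d in nhdsWithin (0 : ℝ) (Set.Ioi 0), d ∈ Set.Ioo (0 : ℝ) 1 :=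
    Ioo_mem_nhdsGT one_pos
  obtain ⟨d, hd, hd0, hd1⟩ := (hev.and hev2).exists
  refine ⟨e * (1 - d), ?_, ?_⟩
  · rw [mul_pow, he]
    nlinarith
  · have h1 : detFun ((X - C (e : ℂ)) * a₁) b (e * (1 - d)) = d * φ d := by
      have h2 : Complex.normSq (((e * (1 - d) : ℝ) : ℂ) - (e : ℂ)) = d ^ 2 := by
        rw [← Complex.ofReal_sub, Complex.normSq_ofReal]
        linear_combination d ^ 2 * he
      simp only [detFun, Polynomial.eval_mul, Polynomial.eval_sub, Polynomial.eval_X,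
        Polynomial.eval_C, Complex.normSq_mul, h2, φ]
      linear_combination (Complex.normSq (b.eval ((e * (1 - d) : ℝ) : ℂ))) * (1 - d) ^ 2 * he
    rw [h1]
    exact mul_neg_of_pos_of_neg hd0 hd

theorem hPoly_dvd_of_roots {a : Polynomial ℂ} (h1 : a.eval 1 = 0) (h2 : a.eval (-1) = 0) :
    ∃ a', a = a' * hPoly := by
  obtain ⟨a₁, rfl⟩ := Polynomial.dvd_iff_isRoot.2 h1
  have h3 : a₁.eval (-1) = 0 := by
    have h4 : ((-1 : ℂ) - 1) * a₁.eval (-1) = 0 := by simpa using h2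
    exact (mul_eq_zero.1 h4).resolve_left (by norm_num)
  obtain ⟨a₂, rfl⟩ := Polynomial.dvd_iff_isRoot.2 h3
  refine ⟨-a₂, ?_⟩
  simp only [map_neg, map_one, hPoly]
  ring

theorem detFun_sign_cases {a b : Polynomial ℂ}
    (hab : ∀ r : ℝ, a.eval (r : ℂ) ≠ 0 ∨ b.eval (r : ℂ) ≠ 0)
    (hne : ∀ r : ℝ, r ^ 2 < 1 → detFun a b r ≠ 0) :
    (∀ r, 0 < detFun a b r) ∨ ((∀ r : ℝ, r ^ 2 < 1 → detFun a b r < 0) ∧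
      ∃ a', a = a' * hPoly ∧ ∀ r, 0 < detFun (conjZ b) (conjZ a') r) := by
  have hIoo : ∀ r : ℝ, r ∈ Set.Ioo (-1 : ℝ) 1 ↔ r ^ 2 < 1 := by
    intro r
    rw [sq_lt_one_iff_abs_lt_one, abs_lt, Set.mem_Ioo]
  have hsign : (∀ r : ℝ, r ^ 2 < 1 → 0 < detFun a b r) ∨
      (∀ r : ℝ, r ^ 2 < 1 → detFun a b r < 0) := by
    by_contra! h
    obtain ⟨⟨r, hr, hr'⟩, s, hs, hs'⟩ := h
    obtain ⟨x, hx, hx'⟩ := (isPreconnected_Ioo (a := (-1 : ℝ)) (b := 1)).intermediate_value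
      ((hIoo r).2 hr) ((hIoo s).2 hs) (continuous_detFun a b).continuousOn ⟨hr', hs'⟩
    exact hne x ((hIoo x).1 hx) hx'
  rcases hsign with hpos | hneg
  · left
    intro r
    rcases lt_trichotomy (r ^ 2) 1 with h | h | h
    · exact hpos r h
    · rw [detFun_of_sq_eq_one h, Complex.normSq_pos]
      intro ha
      obtain ⟨s, hs, hs'⟩ := exists_detFun_neg h ha ((hab r).resolve_left (not_not.2 ha))
      exact absurd (hpos s hs) hs'.not_gt
    · exact detFun_pos_of_one_lt_sq h (hab r)
  · right
    refine ⟨hneg, ?_⟩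
    -- By continuity the determinant is nonpositive at `±1`, where it equals `|a|²`, so `a` vanishes
    -- there.
    have hle : ∀ r ∈ Set.Icc (-1 : ℝ) 1, detFun a b r ≤ 0 := by
      have hcl : IsClosed {r | detFun a b r ≤ 0} :=
        isClosed_le (continuous_detFun a b) continuous_const
      have := closure_minimal (s := Set.Ioo (-1 : ℝ) 1)
        (fun r hr => (hneg r ((hIoo r).1 hr)).le) hcl
      rwa [closure_Ioo (by norm_num)] at this
    have hroot : ∀ r : ℝ, r ^ 2 = 1 → a.eval (r : ℂ) = 0 := by
      intro r hr
      have h1 := hle r (by rw [Set.mem_Icc, ← abs_le, ← sq_le_one_iff_abs_le_one, hr])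
      rw [detFun_of_sq_eq_one hr] at h1
      exact Complex.normSq_eq_zero.1 (le_antisymm h1 (Complex.normSq_nonneg _))
    obtain ⟨a', rfl⟩ := hPoly_dvd_of_roots (by simpa using hroot 1 (by norm_num))
      (by simpa using hroot (-1) (by norm_num))
    refine ⟨a', rfl, fun r => ?_⟩
    have hab' : b.eval (r : ℂ) ≠ 0 ∨ a'.eval (r : ℂ) ≠ 0 := by
      rcases hab r with h | h
      · exact Or.inr (left_ne_zero_of_mul (by rwa [Polynomial.eval_mul] at h))
      · exact Or.inl h
    rw [detFun_conj]
    rcases lt_trichotomy (r ^ 2) 1 with h | h | h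
    · have h1 := hneg r h
      have h2 : detFun (a' * hPoly) b r = -((1 - r ^ 2) * detFun b a' r) := by
        rw [detFun, detFun, Polynomial.eval_mul, eval_hPoly, Complex.normSq_mul,
          Complex.normSq_ofReal]
        ring
      rw [h2] at h1
      exact pos_of_mul_pos_right (neg_neg_iff_pos.1 h1) (by linarith)
    · rw [detFun_of_sq_eq_one h, Complex.normSq_pos]
      exact (hab r).resolve_left (not_not.2 (hroot r h))
    · exact detFun_pos_of_one_lt_sq h hab'

end

section

/-! ## Orientation -/

theorem vol_apply (p u v : E3) : vol p u v =
    p 0 * (u 1 * v 2 - u 2 * v 1) - p 1 * (u 0 * v 2 - u 2 * v 0) +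
      p 2 * (u 0 * v 1 - u 1 * v 0) := by
  rw [vol, Module.Basis.det_apply, Matrix.det_fin_three]
  simp [Module.Basis.toMatrix_apply]
  ring

/-- Three vectors in the plane orthogonal to `f` are dependent. By Cramer's rule each coordinate of
`f` kills the determinant, and `f` is a unit vector. -/
theorem det_eq_zero_of_orthogonal {f₀ f₁ f₂ a₀ a₁ a₂ b₀ b₁ b₂ c₀ c₁ c₂ : ℝ}
    (hf : f₀ ^ 2 + f₁ ^ 2 + f₂ ^ 2 = 1) (ha : f₀ * a₀ + f₁ * a₁ + f₂ * a₂ = 0)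
    (hb : f₀ * b₀ + f₁ * b₁ + f₂ * b₂ = 0) (hc : f₀ * c₀ + f₁ * c₁ + f₂ * c₂ = 0) :
    a₀ * (b₁ * c₂ - b₂ * c₁) - a₁ * (b₀ * c₂ - b₂ * c₀) + a₂ * (b₀ * c₁ - b₁ * c₀) = 0 := by
  set d := a₀ * (b₁ * c₂ - b₂ * c₁) - a₁ * (b₀ * c₂ - b₂ * c₀) + a₂ * (b₀ * c₁ - b₁ * c₀) with hd
  have h0 : f₀ * d = 0 := by
    rw [hd]
    linear_combination (b₁ * c₂ - b₂ * c₁) * ha + (c₁ * a₂ - c₂ * a₁) * hb +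
      (a₁ * b₂ - a₂ * b₁) * hc
  have h1 : f₁ * d = 0 := by
    rw [hd]
    linear_combination (b₂ * c₀ - b₀ * c₂) * ha + (c₂ * a₀ - c₀ * a₂) * hb +
      (a₂ * b₀ - a₀ * b₂) * hc
  have h2 : f₂ * d = 0 := by
    rw [hd]
    linear_combination (b₀ * c₁ - b₁ * c₀) * ha + (c₀ * a₁ - c₁ * a₀) * hb +
      (a₀ * b₁ - a₁ * b₀) * hc
  linear_combination (-d) * hf + f₀ * h0 + f₁ * h1 + f₂ * h2

/-- The Jacobian of a map between spheres whose differential has last row `(0, 0, 1)`. -/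
theorem vol_of_tangent {F p u v Lp Lu Lv : E3} {l₀₀ l₀₁ l₁₀ l₁₁ e f : ℝ} (hF : F ∈ realSphere)
    (hp : p ∈ realSphere) (hu : inner ℝ p u = 0) (hv : inner ℝ p v = 0)
    (hL : ∀ x ∈ [(p, Lp), (u, Lu), (v, Lv)],
      x.2 0 = l₀₀ * x.1 0 + l₀₁ * x.1 1 + e * x.1 2 ∧
      x.2 1 = l₁₀ * x.1 0 + l₁₁ * x.1 1 + f * x.1 2 ∧ x.2 2 = x.1 2 ∧
      F 0 * x.2 0 + F 1 * x.2 1 + F 2 * x.2 2 = inner ℝ p x.1) :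
    vol F Lu Lv = (l₀₀ * l₁₁ - l₀₁ * l₁₀) * vol p u v := by
  simp only [List.mem_cons, List.not_mem_nil, or_false, forall_eq_or_imp, forall_eq] at hL
  obtain ⟨⟨p0, p1, p2, pF⟩, ⟨u0, u1, u2, uF⟩, v0, v1, v2, vF⟩ := hL
  have hpp : inner ℝ p p = (1 : ℝ) := by
    rw [real_inner_self_eq_norm_sq, mem_sphere_zero_iff_norm.1 hp]
    norm_num
  rw [mem_realSphere_iff] at hF
  rw [hpp] at pF
  rw [hu] at uF
  rw [hv] at vF
  -- `Lp - F`, `Lu` and `Lv` are all tangent at `F`. So `F` may be replaced by `Lp` in the volume,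
  -- which leaves the determinant of the linear map.
  have key := det_eq_zero_of_orthogonal (a₀ := Lp 0 - F 0) (a₁ := Lp 1 - F 1) (a₂ := Lp 2 - F 2)
    hF (by linear_combination pF - hF) uF vF
  have h1 : vol F Lu Lv = vol Lp Lu Lv := by
    rw [vol_apply, vol_apply]
    linear_combination -key
  rw [h1, vol_apply, vol_apply, p0, p1, p2, u0, u1, u2, v0, v1, v2]
  ring

/-- The function `t` as a real-linear map. -/
def tvalL : E3 →L[ℝ] ℂ :=
  Complex.ofRealCLM.comp (EuclideanSpace.proj 0) -
    Complex.I • Complex.ofRealCLM.comp (EuclideanSpace.proj 1)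

theorem tvalL_apply (w : E3) : tvalL w = tval w := by
  simp [tvalL, tval]

theorem hasFDerivAt_tval (p : E3) : HasFDerivAt tval tvalL p := by
  have h : tval = tvalL := funext fun w => (tvalL_apply w).symm
  rw [h]
  exact tvalL.hasFDerivAt

theorem hasFDerivAt_eval (q : Polynomial ℂ) (p : E3) :
    HasFDerivAt (fun w : E3 => q.eval (w 2 : ℂ))
      ((q.derivative.eval (p 2 : ℂ)) • Complex.ofRealCLM.comp (EuclideanSpace.proj 2)) p := by
  have h1 : HasFDerivAt (fun w : E3 => (w 2 : ℂ))
      (Complex.ofRealCLM.comp (EuclideanSpace.proj (𝕜 := ℝ) 2)) p :=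
    (Complex.ofRealCLM.comp (EuclideanSpace.proj (𝕜 := ℝ) (2 : Fin 3))).hasFDerivAt
  have h2 := ((q.hasDerivAt (p 2 : ℂ)).hasFDerivAt.restrictScalars ℝ).comp p h1
  refine h2.congr_fderiv ?_
  ext w
  simp [mul_comm]

theorem hasFDerivAt_mval (a b : Polynomial ℂ) (p : E3) :
    ∃ m' : E3 →L[ℝ] ℂ, HasFDerivAt (mval a b) m' p ∧ ∃ k : ℂ, ∀ w,
      m' w = k * (w 2 : ℂ) + b.eval (p 2 : ℂ) * starRingEnd ℂ (tval w) := by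
  have hc : HasFDerivAt (fun w => starRingEnd ℂ (tval w))
      ((Complex.conjCLE : ℂ →L[ℝ] ℂ).comp tvalL) p :=
    (Complex.conjCLE : ℂ →L[ℝ] ℂ).hasFDerivAt.comp p (hasFDerivAt_tval p)
  refine ⟨_, (hasFDerivAt_eval a p).add ((hasFDerivAt_eval b p).mul hc),
    a.derivative.eval (p 2 : ℂ) + b.derivative.eval (p 2 : ℂ) * starRingEnd ℂ (tval p), ?_⟩
  intro w
  simp [tvalL_apply]
  ring

/-- Differentiate `T m̄ = t m` and solve for the derivative of `T`. The dependence of `m` on `z`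
only rotates `T`, hence the purely imaginary multiple of `T` in the last term. -/
theorem hasFDerivAt_Tval {a b : Polynomial ℂ} {p : E3} (hm : mval a b p ≠ 0) :
    ∃ T' : E3 →L[ℝ] ℂ, HasFDerivAt (Tval a b) T' p ∧ ∃ c : ℝ, ∀ w,
      T' w = mval a b p * starRingEnd ℂ (a.eval (p 2 : ℂ)) / starRingEnd ℂ (mval a b p) ^ 2 *
          tval w +
        tval p * b.eval (p 2 : ℂ) / starRingEnd ℂ (mval a b p) * starRingEnd ℂ (tval w) +
        c * Complex.I * Tval a b p * (w 2 : ℂ) := by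
  obtain ⟨m', hm', k, hk⟩ := hasFDerivAt_mval a b p
  have hmc : starRingEnd ℂ (mval a b p) ≠ 0 := by simpa using hm
  have hc : HasFDerivAt (fun w => starRingEnd ℂ (mval a b w))
      ((Complex.conjCLE : ℂ →L[ℝ] ℂ).comp m') p :=
    (Complex.conjCLE : ℂ →L[ℝ] ℂ).hasFDerivAt.comp p hm'
  have hT : DifferentiableAt ℝ (Tval a b) p := by
    have h1 : DifferentiableAt ℝ (fun w => tval w * mval a b w * (starRingEnd ℂ (mval a b w))⁻¹) p :=
      (((hasFDerivAt_tval p).differentiableAt.mul hm'.differentiableAt).mul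
        (hc.differentiableAt.inv hmc))
    exact h1
  have h1 := hT.hasFDerivAt.mul hc
  have h2 := (hasFDerivAt_tval p).mul hm'
  -- This holds even where `m` vanishes, as both sides are then zero.
  have h3 : (Tval a b * fun w => starRingEnd ℂ (mval a b w)) = tval * mval a b := by
    funext w
    change Tval a b w * starRingEnd ℂ (mval a b w) = tval w * mval a b w
    rw [Tval]
    by_cases hw : mval a b w = 0
    · simp [hw]
    · exact div_mul_cancel₀ _ (by simpa using hw)
  have h4 := h1.unique (by rw [h3]; exact h2)
  refine ⟨_, hT.hasFDerivAt, 2 * (k / mval a b p).im, fun w => ?_⟩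
  have h5 := congrArg (fun φ : E3 →L[ℝ] ℂ => φ w) h4
  simp only [add_apply, smul_apply,
    ContinuousLinearMap.comp_apply, hk, tvalL_apply, smul_eq_mul] at h5
  have h6 : (Complex.conjCLE : ℂ →L[ℝ] ℂ) (k * (w 2 : ℂ) +
      b.eval (p 2 : ℂ) * starRingEnd ℂ (tval w)) = starRingEnd ℂ k * (w 2 : ℂ) +
      starRingEnd ℂ (b.eval (p 2 : ℂ)) * tval w := by
    change starRingEnd ℂ _ = _
    simp
  rw [h6] at h5
  have h7 : ((2 * (k / mval a b p).im : ℝ) : ℂ) * Complex.I =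
      k / mval a b p - starRingEnd ℂ k / starRingEnd ℂ (mval a b p) := by
    rw [← map_div₀]
    exact (Complex.sub_conj _).symm
  rw [h7]
  have h8 : fderiv ℝ (Tval a b) p w = (tval p * (k * (w 2 : ℂ) +
      b.eval (p 2 : ℂ) * starRingEnd ℂ (tval w)) + mval a b p * tval w -
      Tval a b p * (starRingEnd ℂ k * (w 2 : ℂ) +
      starRingEnd ℂ (b.eval (p 2 : ℂ)) * tval w)) / starRingEnd ℂ (mval a b p) := by
    rw [eq_div_iff hmc]
    linear_combination h5
  have h9 : starRingEnd ℂ (mval a b p) = starRingEnd ℂ (a.eval (p 2 : ℂ)) +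
      starRingEnd ℂ (b.eval (p 2 : ℂ)) * tval p := by
    simp [mval]
  have h10 : starRingEnd ℂ (a.eval (p 2 : ℂ)) = starRingEnd ℂ (mval a b p) -
      starRingEnd ℂ (b.eval (p 2 : ℂ)) * tval p := by
    rw [h9]; ring
  rw [h8, Tval, h10]
  field_simp
  ring

theorem hasFDerivAt_realMap {a b : Polynomial ℂ} {p : E3} {T' : E3 →L[ℝ] ℂ}
    (h : HasFDerivAt (Tval a b) T' p) :
    ∃ L : E3 →L[ℝ] E3, HasFDerivAt (realMap a b) L p ∧
      ∀ w, L w = !₂[(T' w).re, -(T' w).im, w 2] := by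
  let e := (EuclideanSpace.equiv (Fin 3) ℝ).symm
  let K : E3 →L[ℝ] (Fin 3 → ℝ) := ContinuousLinearMap.pi
    ![Complex.reCLM.comp T', -(Complex.imCLM.comp T'), EuclideanSpace.proj 2]
  have hK : HasFDerivAt (fun w : E3 => ![(Tval a b w).re, -(Tval a b w).im, w 2]) K p := by
    rw [hasFDerivAt_pi']
    intro i
    fin_cases i
    · exact Complex.reCLM.hasFDerivAt.comp p h
    · exact (Complex.imCLM.hasFDerivAt.comp p h).neg
    · exact (EuclideanSpace.proj (𝕜 := ℝ) (2 : Fin 3)).hasFDerivAt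
  refine ⟨(e : (Fin 3 → ℝ) →L[ℝ] E3).comp K, ?_, ?_⟩
  · exact (e : (Fin 3 → ℝ) →L[ℝ] E3).hasFDerivAt.comp p hK
  · intro w
    ext i
    fin_cases i <;> rfl

/-- The planar part of the differential is `s ↦ A s + B s̄`, with determinant `|A|² - |B|²`. Using
`|t|² = h` on the sphere, this is the matrix determinant over `|m|²`. -/
theorem exists_fderiv_realMap {a b : Polynomial ℂ} {p : E3} (hp : p ∈ realSphere)
    (hm : mval a b p ≠ 0) :
    ∃ L : E3 →L[ℝ] E3, HasFDerivAt (realMap a b) L p ∧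
      ∀ u v, inner ℝ p u = 0 → inner ℝ p v = 0 → vol (realMap a b p) (L u) (L v) =
        detFun a b (p 2) / Complex.normSq (mval a b p) * vol p u v := by
  obtain ⟨T', hT', c, hc⟩ := hasFDerivAt_Tval hm
  obtain ⟨L, hL, hLw⟩ := hasFDerivAt_realMap hT'
  refine ⟨L, hL, fun u v hu hv => ?_⟩
  have hmc : starRingEnd ℂ (mval a b p) ≠ 0 := by simpa using hm
  set A := mval a b p * starRingEnd ℂ (a.eval (p 2 : ℂ)) / starRingEnd ℂ (mval a b p) ^ 2 with hA
  set B := tval p * b.eval (p 2 : ℂ) / starRingEnd ℂ (mval a b p) with hB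
  set T := Tval a b p with hT
  -- The infinitesimal form of `|T| = |t|`; it yields the inner product identity required by
  -- `vol_of_tangent`.
  have hAB : starRingEnd ℂ T * A + T * starRingEnd ℂ B = starRingEnd ℂ (tval p) := by
    have h9 : starRingEnd ℂ (mval a b p) = starRingEnd ℂ (a.eval (p 2 : ℂ)) +
        starRingEnd ℂ (b.eval (p 2 : ℂ)) * tval p := by
      simp [mval]
    have h10 : starRingEnd ℂ (a.eval (p 2 : ℂ)) = starRingEnd ℂ (mval a b p) -
        starRingEnd ℂ (b.eval (p 2 : ℂ)) * tval p := by
      rw [h9]; ring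
    rw [hA, hB, hT, Tval, h10]
    simp only [map_div₀, map_mul, Complex.conj_conj]
    field_simp
    ring
  have hJ : (A.re + B.re) * (A.re - B.re) - (A.im - B.im) * (-(A.im + B.im)) =
      detFun a b (p 2) / Complex.normSq (mval a b p) := by
    have h1 : (A.re + B.re) * (A.re - B.re) - (A.im - B.im) * (-(A.im + B.im)) =
        Complex.normSq A - Complex.normSq B := by
      rw [Complex.normSq_apply, Complex.normSq_apply]
      ring
    have hn : Complex.normSq (mval a b p) ≠ 0 := by simpa using hm
    rw [h1, hA, hB, detFun, ← normSq_tval_of_mem hp]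
    simp only [Complex.normSq_div, Complex.normSq_mul, Complex.normSq_conj, map_pow]
    field_simp
  rw [← hJ]
  refine vol_of_tangent (Lp := L p) (e := -c * T.im) (f := -c * T.re) (realMap_mem hp hm) hp hu hv ?_
  have hgen : ∀ w, (L w) 0 = (A.re + B.re) * w 0 + (A.im - B.im) * w 1 + (-c * T.im) * w 2 ∧
      (L w) 1 = (-(A.im + B.im)) * w 0 + (A.re - B.re) * w 1 + (-c * T.re) * w 2 ∧
      (L w) 2 = w 2 ∧ realMap a b p 0 * (L w) 0 + realMap a b p 1 * (L w) 1 +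
        realMap a b p 2 * (L w) 2 = inner ℝ p w := by
    intro w
    have e0 : (L w) 0 = (A.re + B.re) * w 0 + (A.im - B.im) * w 1 + (-c * T.im) * w 2 := by
      rw [hLw]
      simp [hc, tval]
      ring
    have e1 : (L w) 1 = (-(A.im + B.im)) * w 0 + (A.re - B.re) * w 1 + (-c * T.re) * w 2 := by
      rw [hLw]
      simp [hc, tval]
      ring
    have e2 : (L w) 2 = w 2 := by rw [hLw]; rfl
    refine ⟨e0, e1, e2, ?_⟩
    have r0 : realMap a b p 0 = T.re := rfl
    have r1 : realMap a b p 1 = -T.im := rfl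
    have r2 : realMap a b p 2 = p 2 := rfl
    have hin : inner ℝ p w = p 0 * w 0 + p 1 * w 1 + p 2 * w 2 := by
      simp [PiLp.inner_apply, Fin.sum_univ_three]
      ring
    have i0 := congrArg Complex.re hAB
    have i1 := congrArg Complex.im hAB
    simp [tval] at i0 i1
    rw [e0, e1, e2, r0, r1, r2, hin]
    linear_combination w 0 * i0 + w 1 * i1
  intro x hx
  simp only [List.mem_cons, List.not_mem_nil, or_false] at hx
  rcases hx with rfl | rfl | rfl <;> exact hgen _

end

/-! ### Orientation behaviour and assembly of the groups. -/

section

open Matrix.ProjGenLinGroup (mk)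
open scoped Topology

/-- A derivative within the sphere is determined only on tangent vectors; there it is the velocity
of `F` along the great circle through `p` in direction `u`. -/
theorem fderiv_eq_on_tangent {F : E3 → E3} {L L' : E3 →L[ℝ] E3} {p u : E3} (hp : p ∈ realSphere)
    (hu : ‖u‖ = 1) (hpu : inner ℝ p u = 0) (h : HasFDerivWithinAt F L realSphere p)
    (h' : HasFDerivWithinAt F L' realSphere p) : L u = L' u := by
  let γ : ℝ → E3 := fun s => Real.cos s • p + Real.sin s • u
  have hγ0 : γ 0 = p := by simp [γ]
  have hγ : HasDerivAt γ u 0 := by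
    have := ((Real.hasDerivAt_cos 0).smul_const p).add ((Real.hasDerivAt_sin 0).smul_const u)
    simpa using! this
  have hmem : ∀ s, γ s ∈ realSphere := by
    intro s
    rw [mem_sphere_zero_iff_norm] at hp ⊢
    have h1 : ‖γ s‖ ^ 2 = 1 := by
      rw [norm_add_sq_real, norm_smul, norm_smul, inner_smul_left, inner_smul_right, hpu, hp, hu]
      simp
    nlinarith [norm_nonneg (γ s)]
  have key : ∀ {L : E3 →L[ℝ] E3}, HasFDerivWithinAt F L realSphere p →
      HasDerivAt (F ∘ γ) (L u) 0 := by
    intro L h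
    rw [← hγ0] at h
    exact h.comp_hasDerivAt 0 hγ (Filter.Eventually.of_forall hmem)
  exact (key h).unique (key h')

theorem IsStd.mem_autRealOverPlus {A : PGL(2, RatFunc ℂ)} {a b : Polynomial ℂ} (hA : IsStd A a b)
    {f : BirC} (hf : PsiConj f A) (hpos : ∀ r, 0 < detFun a b r) : f ∈ autRealOverPlus := by
  refine ⟨hA.mem_autRealOver hf fun r => (hpos r).ne', realMap a b, ?_, ?_⟩
  · intro p hp
    have hm := mval_ne_zero hp (hpos (p 2)).ne'
    exact ⟨realMap_mem hp hm, (mapsPt_iff_hasImageAt hp).1 (hA.mapsPt hf hp hm)⟩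
  · intro p hp
    have hm := mval_ne_zero hp (hpos (p 2)).ne'
    obtain ⟨L, hL, hvol⟩ := exists_fderiv_realMap hp hm
    refine ⟨L, hL.hasFDerivWithinAt, fun u v hu hv huv => ?_⟩
    rw [hvol u v hu hv]
    exact mul_pos (div_pos (hpos _) (Complex.normSq_pos.2 hm)) huv

/-- One equatorial point suffices: near it `F` must agree with `realMap a b`, whose Jacobian is
negative there. -/
theorem IsStd.not_preservesOrientation {A : PGL(2, RatFunc ℂ)} {a b : Polynomial ℂ}
    (hA : IsStd A a b) {f : BirC} (hf : PsiConj f A)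
    (hneg : ∀ r : ℝ, r ^ 2 < 1 → detFun a b r < 0) {F : E3 → E3} (hF : Induces f F) :
    ¬ PreservesOrientation F := by
  intro hor
  set p : E3 := EuclideanSpace.single 0 1 with hp'
  set u : E3 := EuclideanSpace.single 1 1 with hu'
  set v : E3 := EuclideanSpace.single 2 1 with hv'
  have hp : p ∈ realSphere := by simp [hp']
  have hpu : inner ℝ p u = 0 := by simp [hp', hu', PiLp.inner_apply]
  have hpv : inner ℝ p v = 0 := by simp [hp', hv', PiLp.inner_apply]
  have hvol : 0 < vol p u v := by simp [vol_apply, hp', hu', hv']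
  have hp2 : p 2 = 0 := by simp [hp']
  have heq : ∀ q ∈ realSphere, q 2 ^ 2 < 1 → F q = realMap a b q := by
    intro q hq hq2
    have hm := mval_ne_zero hq (hneg _ hq2).ne
    exact ((mapsPt_iff_hasImageAt hq).2 (hF q hq).2).unique hq (hA.mapsPt hf hq hm)
  have hp2' : p 2 ^ 2 < 1 := by rw [hp2]; norm_num
  have hm := mval_ne_zero hp (hneg _ hp2').ne
  obtain ⟨L, hL, hLpos⟩ := hor p hp
  obtain ⟨L', hL', hLvol⟩ := exists_fderiv_realMap hp hm
  have hopen : IsOpen {q : E3 | q 2 ^ 2 < 1} :=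
    isOpen_lt (by fun_prop) continuous_const
  have hev : F =ᶠ[𝓝[realSphere] p] realMap a b := by
    filter_upwards [self_mem_nhdsWithin, nhdsWithin_le_nhds (hopen.mem_nhds hp2')] with q hq hq2
    exact heq q hq hq2
  have hL'' : HasFDerivWithinAt F L' realSphere p :=
    hL'.hasFDerivWithinAt.congr_of_eventuallyEq hev (heq p hp hp2')
  have h1 := hLpos u v hpu hpv hvol
  rw [fderiv_eq_on_tangent hp (by simp [hu']) hpu hL hL'',
    fderiv_eq_on_tangent hp (by simp [hv']) hpv hL hL'', heq p hp hp2', hLvol u v hpu hpv] at h1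
  have h2 : detFun a b (p 2) / Complex.normSq (mval a b p) < 0 :=
    div_neg_of_neg_of_pos (hneg _ hp2') (Complex.normSq_pos.2 hm)
  exact absurd h1 (mul_neg_of_neg_of_pos h2 hvol).not_gt

/-! ## The groups `ℋ` and `ℋ₀` -/

theorem conj_mem_explicitH0 {A : PGL(2, RatFunc ℂ)} (hA : A ∈ explicitH0) :
    tau * A * tau ∈ explicitH0 := by
  rw [mem_explicitH0_iff] at hA ⊢
  obtain ⟨a, b, hpos, hA⟩ := hA
  exact ⟨_, _, fun r => by rw [detFun_conj]; exact hpos r, hA.conj⟩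

/-- The group `ℋ₀`. -/
def groupH0 : Subgroup (PGL(2, RatFunc ℂ)) where
  carrier := explicitH0
  one_mem' := by
    rw [mem_explicitH0_iff]
    exact ⟨1, 0, fun r => by simp [detFun], isStd_one⟩
  mul_mem' := by
    intro A B hA hB
    rw [mem_explicitH0_iff] at *
    obtain ⟨a, b, hab, hA⟩ := hA
    obtain ⟨c, d, hcd, hB⟩ := hB
    exact ⟨_, _, fun r => by rw [detFun_mul]; exact mul_pos (hab r) (hcd r), hA.mul hB⟩
  inv_mem' := by
    intro A hA
    rw [mem_explicitH0_iff] at *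
    obtain ⟨a, b, hab, hA⟩ := hA
    exact ⟨_, _, fun r => by rw [detFun_inv]; exact hab r, hA.inv⟩

theorem tau_mul_tau_mul (A : PGL(2, RatFunc ℂ)) : tau * (tau * A) = A := by
  rw [← mul_assoc, tau_mul_tau, one_mul]

theorem conj_mem_groupH0 {A : PGL(2, RatFunc ℂ)} (hA : A ∈ groupH0) : tau * A * tau ∈ groupH0 :=
  conj_mem_explicitH0 hA

theorem tau_inv : tau⁻¹ = tau := (eq_inv_of_mul_eq_one_right tau_mul_tau).symm

/-- The group `ℋ`. -/
def groupH : Subgroup (PGL(2, RatFunc ℂ)) where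
  carrier := {A | A ∈ groupH0 ∨ tau * A ∈ groupH0}
  one_mem' := Or.inl groupH0.one_mem
  mul_mem' := by
    rintro A B (hA | hA) (hB | hB)
    · exact Or.inl (mul_mem hA hB)
    · right
      -- Uses `τAB = (τAτ)(τB)`.
      have := mul_mem (conj_mem_groupH0 hA) hB
      rwa [mul_assoc, tau_mul_tau_mul, mul_assoc] at this
    · right
      rw [← mul_assoc]
      exact mul_mem hA hB
    · left
      have := mul_mem (conj_mem_groupH0 hA) hB
      rwa [mul_assoc, tau_mul_tau_mul, tau_mul_tau_mul] at this
  inv_mem' := by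
    rintro A (hA | hA)
    · exact Or.inl (inv_mem hA)
    · right
      have := conj_mem_groupH0 (inv_mem hA)
      rwa [mul_inv_rev, tau_inv, mul_assoc, mul_assoc, tau_mul_tau, mul_one] at this

theorem mem_groupH0 {A : PGL(2, RatFunc ℂ)} :
    A ∈ groupH0 ↔ ∃ a b, (∀ r, 0 < detFun a b r) ∧ IsStd A a b :=
  mem_explicitH0_iff A

/-- A standard matrix representing `τ` has `a = 0`, so its determinant at `0` is `-|b(0)|² ≤ 0`. -/
theorem tau_notMem_groupH0 : tau ∉ groupH0 := by
  rw [mem_groupH0]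
  rintro ⟨a, b, hpos, hA⟩
  obtain ⟨M, hM, h00, -, -, -⟩ := hA.exists_entries
  obtain ⟨k, -, hk⟩ := exists_smul_of_mk_eq_mk (M := tauGL) (N := M) hM.symm
  have h := hk 0 0
  rw [tauGL_00, zero_mul, h00] at h
  have ha : a = 0 := RatFunc.algebraMap_injective ℂ (by rw [← h, map_zero])
  have := hpos 0
  rw [ha] at this
  simp only [detFun, Polynomial.eval_zero, map_zero] at this
  have h2 := Complex.normSq_nonneg (b.eval ((0 : ℝ) : ℂ))
  linarith

/-- The negative alternative also keeps the original matrix, because its negative determinant is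
what rules out preservation of orientation. -/
theorem sign_cases_of_mem_autRealOver {f : BirC} {A : PGL(2, RatFunc ℂ)} (hf : f ∈ autRealOver)
    (hA : PsiConj f A) : A ∈ groupH0 ∨ (tau * A ∈ groupH0 ∧ ∃ a b, IsStd A a b ∧
      ∀ r : ℝ, r ^ 2 < 1 → detFun a b r < 0) := by
  obtain ⟨a, b, hab, hstd⟩ := exists_isStd_of_mem_scriptG (hA.mem_birS_iff.1 hf.1.1)
  have hne : ∀ r : ℝ, r ^ 2 < 1 → detFun a b r ≠ 0 := fun r hr =>
    hstd.detFun_ne_zero hA hf.1.2.2 hr (hab r)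
  rcases detFun_sign_cases hab hne with h | ⟨hneg, a', rfl, hpos⟩
  · exact Or.inl (mem_groupH0.2 ⟨a, b, h, hstd⟩)
  · exact Or.inr ⟨mem_groupH0.2 ⟨_, _, hpos, hstd.tau_mul_of_dvd⟩, _, b, hstd, hneg⟩

theorem coe_groupH : (groupH : Set (PGL(2, RatFunc ℂ))) = psiImage autRealOver := by
  have h0 : ∀ {A : PGL(2, RatFunc ℂ)}, A ∈ groupH0 → ∃ f ∈ autRealOver, PsiConj f A := by
    intro A hA
    obtain ⟨a, b, hpos, hstd⟩ := mem_groupH0.1 hA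
    obtain ⟨f, hf⟩ := exists_psiConj_left A
    exact ⟨f, hstd.mem_autRealOver hf fun r => (hpos r).ne', hf⟩
  ext A
  constructor
  · rintro (hA | hA)
    · exact h0 hA
    · obtain ⟨f, hf, hfA⟩ := h0 hA
      obtain ⟨k, hk⟩ := exists_psiConj_left tau
      refine ⟨k * f, autRealOver_mul (mem_autRealOver_of_tau hk) hf, ?_⟩
      have := hk.mul hfA
      rwa [tau_mul_tau_mul] at this
  · rintro ⟨f, hf, hfA⟩
    exact (sign_cases_of_mem_autRealOver hf hfA).imp id And.left

theorem coe_groupH0 : (groupH0 : Set (PGL(2, RatFunc ℂ))) = psiImage autRealOverPlus := by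
  ext A
  constructor
  · intro hA
    obtain ⟨a, b, hpos, hstd⟩ := mem_groupH0.1 hA
    obtain ⟨f, hf⟩ := exists_psiConj_left A
    exact ⟨f, hstd.mem_autRealOverPlus hf hpos, hf⟩
  · rintro ⟨f, ⟨hf, F, hF, hor⟩, hfA⟩
    rcases sign_cases_of_mem_autRealOver hf hfA with h | ⟨-, a, b, hstd, hneg⟩
    · exact h
    · exact absurd hor (hstd.not_preservesOrientation hfA hneg hF)

end

end SphereBir

end

/-! ### The isomorphisms and the semidirect product. -/

open SphereBir in
theorem mainTheorem12 :
    ∃ (G Gplus : Subgroup BirC) (H H₀ : Subgroup (PGL(2, RatFunc ℂ))),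
      (G : Set BirC) = autRealOver ∧
      (Gplus : Set BirC) = autRealOverPlus ∧
      (H : Set (PGL(2, RatFunc ℂ))) = psiImage autRealOver ∧
      (H₀ : Set (PGL(2, RatFunc ℂ))) = psiImage autRealOverPlus ∧
      (∃ Θ : G ≃* H, ∀ f : G, PsiConj (f : BirC) (Θ f : PGL(2, RatFunc ℂ))) ∧
      (∃ Θ₀ : Gplus ≃* H₀, ∀ f : Gplus, PsiConj (f : BirC) (Θ₀ f : PGL(2, RatFunc ℂ))) ∧
      (H : Set (PGL(2, RatFunc ℂ))) ⊆ scriptG ∧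
      H₀ ≤ H ∧
      (H₀.subgroupOf H).Normal ∧
      orderOf tau = 2 ∧
      H₀ ⊓ Subgroup.zpowers tau = ⊥ ∧
      H₀ ⊔ Subgroup.zpowers tau = H ∧
      (H₀ : Set (PGL(2, RatFunc ℂ))) = explicitH0 := by
  have hover : ∀ f ∈ autRealOver, f ∈ birOver := fun f hf => hf.2
  have hoverPlus : ∀ f ∈ autRealOverPlus, f ∈ birOver := fun f hf => hf.1.2
  obtain ⟨G, hG⟩ := exists_subgroup_of_psiImage groupH _ hover coe_groupH
  obtain ⟨Gplus, hGplus⟩ := exists_subgroup_of_psiImage groupH0 _ hoverPlus coe_groupH0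
  have hle : groupH0 ≤ groupH := fun A hA => Or.inl hA
  have horder : orderOf tau = 2 := by
    refine orderOf_eq_prime (by rw [pow_two, tau_mul_tau]) ?_
    intro h
    exact tau_notMem_groupH0 (h ▸ groupH0.one_mem)
  have hzpow : ∀ A ∈ Subgroup.zpowers tau, A = 1 ∨ A = tau := by
    intro A hA
    obtain ⟨n, rfl⟩ := Subgroup.mem_zpowers_iff.1 hA
    rcases Int.even_or_odd' n with ⟨k, rfl | rfl⟩
    · left
      rw [zpow_mul, zpow_ofNat, pow_two, tau_mul_tau, one_zpow]
    · right
      rw [zpow_add, zpow_mul, zpow_ofNat, pow_two, tau_mul_tau, one_zpow, one_mul, zpow_one]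
  refine ⟨G, Gplus, groupH, groupH0, hG, hGplus, coe_groupH, coe_groupH0,
    exists_mulEquiv_of_psiImage G groupH (fun f hf => hover f (hG ▸ hf)) (by rw [hG, coe_groupH]),
    exists_mulEquiv_of_psiImage Gplus groupH0 (fun f hf => hoverPlus f (hGplus ▸ hf))
      (by rw [hGplus, coe_groupH0]), ?_, hle, ?_, horder, ?_, ?_, rfl⟩
  · rw [coe_groupH]
    rintro A ⟨f, hf, hfA⟩
    exact hfA.mem_birS_iff.1 hf.1.1
  · rw [Subgroup.normal_subgroupOf_iff hle]
    rintro A B hA (hB | hB)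
    · exact mul_mem (mul_mem hB hA) (inv_mem hB)
    · have h := conj_mem_groupH0 (mul_mem (mul_mem hB hA) (inv_mem hB))
      have e : tau * (tau * B * A * (tau * B)⁻¹) * tau = B * A * B⁻¹ := by
        rw [mul_inv_rev, tau_inv]
        simp only [mul_assoc, tau_mul_tau, mul_one, tau_mul_tau_mul]
      rwa [e] at h
  · rw [eq_bot_iff]
    rintro A ⟨hA, hA'⟩
    rcases hzpow A hA' with rfl | rfl
    · exact Subgroup.mem_bot.2 rfl
    · exact absurd hA tau_notMem_groupH0
  · apply le_antisymm
    · rw [sup_le_iff, Subgroup.zpowers_le]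
      exact ⟨hle, Or.inr (by rw [tau_mul_tau]; exact groupH0.one_mem)⟩
    · rintro A (hA | hA)
      · exact Subgroup.mem_sup_left hA
      · have := mul_mem (Subgroup.mem_sup_right (Subgroup.mem_zpowers tau) :
          tau ∈ groupH0 ⊔ Subgroup.zpowers tau) (Subgroup.mem_sup_left hA)
        rwa [tau_mul_tau_mul] at this
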